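/- Let $p\ge 1$ be an integer, $q=e^{2\pi i/p}$, $R=\mathbb{C}[z,z^{-1}]$, and let $\sigma$ be the $\mathbb{C}$-algebra automorphism of $R$ with $\sigma(z)=q^{-1}z$. Let $\omega=\{(z-q^k)\mid 0\le k\le p-1\}$, the $\sigma$-orbit of the maximal ideal $(z-1)$, and let $\mathsf{M}_0=\{(z-1)^n\mid n\ge 0\}$. For $t\in\mathsf{M}_0$ let $A(t)$ be the generalized Weyl algebra obtained from $R$ by adjoining generators $X,Y$ with relations $Xr=\sigma(r)X$, $Yr=\sigma^{-1}(r)Y$ $(r\in R)$, $YX=t$, $XY=\sigma(t)$. Let $A(t)\text{-wmod}_\omega$ be the category of $A(t)$-modules $M$ such that $M=\bigoplus_{\mathfrak m\in\operatorname{MaxSpec}(R)}M_{\mathfrak m}$, where $M_{\mathfrak m}=\{v\in M\mid \mathfrak m v=0\}$, each $M_{\mathfrak m}$ is finite-dimensional over $R/\mathfrak m$, and $M_{\mathfrak m}=0$ for $\mathfrak m\notin\omega$. If $M\in A(t)\text{-wmod}_\omega$ and $N\in A(t')\text{-wmod}_\omega$, then $M\otimes_R N$ is an object of $A(tt')\text{-wmod}_\omega$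 with $X(v\otimes w)=Xv\otimes Xw$ and $Y(v\otimes w)=Yv\otimes Yw$. Let $$\mathscr{A}(\omega,\mathsf{M}_0)=\bigoplus_{t\in\mathsf{M}_0}\mathbb{C}\otimes_{\mathbb Z}K_0\big(A(t)\text{-wmod}_\omega\big),\qquad \mathscr{A}^{\mathrm{split}}(\omega,\mathsf{M}_0)=\bigoplus_{t\in\mathsf{M}_0}\mathbb{C}\otimes_{\mathbb Z}K_0^{\mathrm{split}}\big(A(t)\text{-wmod}_\omega\big),$$ where $K_0$ is the Grothendieck group (with relations $[M]=[M']+[M'']$ for all short exact sequences $0\to M'\to M\to M''\to 0$) and $K_0^{\mathrm{split}}$ is the split Grothendieck group (with relations $[M'\oplus M'']=[M']+[M'']$). Both are commutative $\mathbb{C}$-algebras with multiplication $[M][N]=[M\otimes_R N]$, and $[M]\mapsto[M]$ defines an algebra map $\pi:\mathscr{A}^{\mathrm{split}}(\omega,\mathsf{M}_0)\to\mathscr{A}(\omega,\mathsf{M}_0)$. Let $\mathscr{A}_{(1)}\subseteq\mathscr{A}^{\mathrm{split}}(\omega,\mathsf{M}_0)$ be the subspace spanned by the classes of indecomposable modules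 of length at most $1$ in the categories $A(t)\text{-wmod}_\omega$, $t\in\mathsf{M}_0$. Then the following hold. 1. If $t,t'\in\mathsf{M}_0$ and $M\in A(t)\text{-wmod}_\omega$, $N\in A(t')\text{-wmod}_\omega$ are simple modules over $A(t)$ and $A(t')$, then $M\otimes_R N$ is a simple $A(tt')$-module. 2. $\mathscr{A}_{(1)}$ is the span of the classes of simple modules, and it is a (unital) subalgebra of $\mathscr{A}^{\mathrm{split}}(\omega,\mathsf{M}_0)$. 3. $\pi$ is surjective, and there is a homomorphism of $\mathbb{C}$-algebras $s:\mathscr{A}(\omega,\mathsf{M}_0)\to\mathscr{A}^{\mathrm{split}}(\omega,\mathsf{M}_0)$ with $\pi\circ s=\mathrm{id}$ that gives an isomorphism of algebras $\mathscr{A}(\omega,\mathsf{M}_0)\cong\mathscr{A}_{(1)}$. -/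

import Mathlib

open scoped TensorProduct DirectSum

noncomputable section

namespace WeightRing

/-! ### Generalized Weyl algebras -/

/-- Generators of the generalized Weyl algebra `A(R, σ, t)`: the elements of `R`, and `X`, `Y`. -/
inductive GWAGen (R : Type) : Type
  | coe (r : R)
  | X
  | Y

/-- Defining relations of `A(R, σ, t)`. The first three say that `R → A(R, σ, t)` is a ring
homomorphism. -/
inductive GWARel {R : Type} [CommRing R] (σ : R ≃+* R) (t : R) :
    FreeAlgebra ℤ (GWAGen R) → FreeAlgebra ℤ (GWAGen R) → Prop
  | one : GWARel σ t (FreeAlgebra.ι ℤ (.coe 1)) 1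
  | add (r s : R) : GWARel σ t (FreeAlgebra.ι ℤ (.coe (r + s)))
      (FreeAlgebra.ι ℤ (.coe r) + FreeAlgebra.ι ℤ (.coe s))
  | mul (r s : R) : GWARel σ t (FreeAlgebra.ι ℤ (.coe (r * s)))
      (FreeAlgebra.ι ℤ (.coe r) * FreeAlgebra.ι ℤ (.coe s))
  | X_coe (r : R) : GWARel σ t (FreeAlgebra.ι ℤ .X * FreeAlgebra.ι ℤ (.coe r))
      (FreeAlgebra.ι ℤ (.coe (σ r)) * FreeAlgebra.ι ℤ .X)
  | Y_coe (r : R) : GWARel σ t (FreeAlgebra.ι ℤ .Y * FreeAlgebra.ι ℤ (.coe r))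
      (FreeAlgebra.ι ℤ (.coe (σ.symm r)) * FreeAlgebra.ι ℤ .Y)
  | Y_X : GWARel σ t (FreeAlgebra.ι ℤ .Y * FreeAlgebra.ι ℤ .X) (FreeAlgebra.ι ℤ (.coe t))
  | X_Y : GWARel σ t (FreeAlgebra.ι ℤ .X * FreeAlgebra.ι ℤ .Y) (FreeAlgebra.ι ℤ (.coe (σ t)))

/-- The generalized Weyl algebra `A(t) = A(R, σ, t)` of rank one. -/
def GWA {R : Type} [CommRing R] (σ : R ≃+* R) (t : R) : Type := RingQuot (GWARel σ t)

namespace GWA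

variable {R : Type} [CommRing R] (σ : R ≃+* R) (t : R)

instance : Ring (GWA σ t) := inferInstanceAs (Ring (RingQuot (GWARel σ t)))

/-- The quotient map from the free algebra. -/
def mk : FreeAlgebra ℤ (GWAGen R) →+* GWA σ t := RingQuot.mkRingHom (GWARel σ t)

theorem mk_surjective : Function.Surjective (mk σ t) := RingQuot.mkRingHom_surjective _

theorem mk_rel {σ : R ≃+* R} {t : R} {a b : FreeAlgebra ℤ (GWAGen R)} (h : GWARel σ t a b) : mk σ t a = mk σ t b :=
  RingQuot.mkRingHom_rel h

/-- The generator `X`. -/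
def X : GWA σ t := mk σ t (FreeAlgebra.ι ℤ .X)

/-- The generator `Y`. -/
def Y : GWA σ t := mk σ t (FreeAlgebra.ι ℤ .Y)

/-- The structure map `R → A(t)`. -/
def incl : R →+* GWA σ t where
  toFun r := mk σ t (FreeAlgebra.ι ℤ (.coe r))
  map_one' := by rw [mk_rel .one, map_one]
  map_mul' r s := by rw [mk_rel (.mul r s), map_mul]
  map_zero' := by
    have h := mk_rel (σ := σ) (t := t) (.add 0 0)
    rw [map_add, add_zero] at h
    exact left_eq_add.mp h
  map_add' r s := by rw [mk_rel (.add r s), map_add]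

theorem X_incl (r : R) : X σ t * incl σ t r = incl σ t (σ r) * X σ t := by
  have h := mk_rel (σ := σ) (t := t) (.X_coe r)
  simp only [map_mul] at h
  exact h

theorem Y_incl (r : R) : Y σ t * incl σ t r = incl σ t (σ.symm r) * Y σ t := by
  have h := mk_rel (σ := σ) (t := t) (.Y_coe r)
  simp only [map_mul] at h
  exact h

theorem Y_X : Y σ t * X σ t = incl σ t t := by
  have h := mk_rel (σ := σ) (t := t) .Y_X
  simp only [map_mul] at h
  exact h

theorem X_Y : X σ t * Y σ t = incl σ t (σ t) := by
  have h := mk_rel (σ := σ) (t := t) .X_Y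
  simp only [map_mul] at h
  exact h

/-- `A(t)` as a left `R`-module, so that `IsScalarTower R A(t) V` says that the `R`-module
structure of an `A(t)`-module `V` is the one obtained by restriction along `R → A(t)`. -/
instance : Module R (GWA σ t) := Module.compHom _ (incl σ t)

theorem smul_def (r : R) (a : GWA σ t) : r • a = incl σ t r * a := rfl

variable {V W : Type} [AddCommGroup V] [Module R V] [AddCommGroup W] [Module R W]

section modules
variable [Module (GWA σ t) V] [IsScalarTower R (GWA σ t) V]
  [Module (GWA σ t) W] [IsScalarTower R (GWA σ t) W]

theorem incl_smul (r : R) (v : V) : incl σ t r • v = r • v := by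
  have h := smul_assoc r (1 : GWA σ t) v
  rwa [smul_def, mul_one, one_smul] at h

/-- The action of `X`, a `σ`-semilinear map. -/
def actX : V →ₛₗ[(σ : R →+* R)] V where
  toFun v := X σ t • v
  map_add' := smul_add _
  map_smul' r v := by
    rw [← incl_smul σ t, ← mul_smul, X_incl, mul_smul, incl_smul]; rfl

/-- The action of `Y`, a `σ⁻¹`-semilinear map. -/
def actY : V →ₛₗ[(σ.symm : R →+* R)] V where
  toFun v := Y σ t • v
  map_add' := smul_add _
  map_smul' r v := by
    rw [← incl_smul σ t, ← mul_smul, Y_incl, mul_smul, incl_smul]; rfl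

theorem actY_actX (v : V) : actY σ t (actX σ t v) = t • v := by
  change Y σ t • X σ t • v = _
  rw [← mul_smul, Y_X, incl_smul]

theorem actX_actY (v : V) : actX σ t (actY σ t v) = σ t • v := by
  change X σ t • Y σ t • v = _
  rw [← mul_smul, X_Y, incl_smul]

/-- An `A(t)`-linear map is `R`-linear. -/
def restrict (f : V →ₗ[GWA σ t] W) : V →ₗ[R] W where
  toFun := f
  map_add' := map_add f
  map_smul' r v := by
    rw [← incl_smul σ t, map_smul, incl_smul]; rfl

end modules

section hom

variable {σ : R ≃+* R} {t : R}
  [Module (GWA σ t) V] [IsScalarTower R (GWA σ t) V]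
  [Module (GWA σ t) W] [IsScalarTower R (GWA σ t) W]

/-- An `R`-linear map that commutes with `X` and `Y` is `A(t)`-linear. -/
def linearMapOf (f : V →ₗ[R] W) (hX : ∀ v, f (X σ t • v) = X σ t • f v)
    (hY : ∀ v, f (Y σ t • v) = Y σ t • f v) : V →ₗ[GWA σ t] W where
  toFun := f
  map_add' := map_add f
  map_smul' a v := by
    obtain ⟨a, rfl⟩ := mk_surjective σ t a
    induction a using FreeAlgebra.induction generalizing v with
    | grade0 n => simp [Int.cast_smul_eq_zsmul]
    | grade1 x =>
      cases x with
      | coe r =>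
        change f (incl σ t r • v) = incl σ t r • f v
        rw [incl_smul, incl_smul, map_smul]
      | X => exact hX v
      | Y => exact hY v
    | mul a b ha hb => simp only [map_mul, mul_smul, RingHom.id_apply] at *; rw [ha, hb]
    | add a b ha hb => simp only [map_add, add_smul, RingHom.id_apply] at *; rw [ha, hb]

/-- An `R`-linear equivalence that commutes with `X` and `Y` is `A(t)`-linear. -/
def linearEquivOf (f : V ≃ₗ[R] W) (hX : ∀ v, f (X σ t • v) = X σ t • f v)
    (hY : ∀ v, f (Y σ t • v) = Y σ t • f v) : V ≃ₗ[GWA σ t] W :=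
  { linearMapOf f.toLinearMap hX hY with
    invFun := f.symm
    left_inv := f.left_inv
    right_inv := f.right_inv }

end hom

section ofAction
variable {σ t}

/-- Operators satisfying the defining relations give a representation of `A(t)`. -/
def rep (x : V →ₛₗ[(σ : R →+* R)] V) (y : V →ₛₗ[(σ.symm : R →+* R)] V)
    (hyx : ∀ v, y (x v) = t • v) (hxy : ∀ v, x (y v) = σ t • v) :
    GWA σ t →+* AddMonoid.End V :=
  RingQuot.lift ⟨((FreeAlgebra.lift ℤ (fun g : GWAGen R => match g with
    | .coe r => (DistribSMul.toAddMonoidHom V r : AddMonoid.End V)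
    | .X => (x.toAddMonoidHom : AddMonoid.End V)
    | .Y => (y.toAddMonoidHom : AddMonoid.End V)) :
      FreeAlgebra ℤ (GWAGen R) →ₐ[ℤ] AddMonoid.End V) :
      FreeAlgebra ℤ (GWAGen R) →+* AddMonoid.End V), by
    intro a b h
    cases h <;> refine AddMonoidHom.ext fun v => ?_ <;>
      simp only [RingHom.coe_coe, map_mul, map_add, map_one, FreeAlgebra.lift_ι_apply]
    case one => exact one_smul R v
    case add r s => exact add_smul r s v
    case mul r s => exact mul_smul r s v
    case X_coe r => exact x.map_smulₛₗ r v
    case Y_coe r => exact y.map_smulₛₗ r v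
    case Y_X => exact hyx v
    case X_Y => exact hxy v⟩

/-- The `A(t)`-module structure given by operators satisfying the defining relations. -/
abbrev moduleOf (x : V →ₛₗ[(σ : R →+* R)] V) (y : V →ₛₗ[(σ.symm : R →+* R)] V)
    (hyx : ∀ v, y (x v) = t • v) (hxy : ∀ v, x (y v) = σ t • v) :
    Module (GWA σ t) V := Module.compHom V (rep x y hyx hxy)

variable (x : V →ₛₗ[(σ : R →+* R)] V) (y : V →ₛₗ[(σ.symm : R →+* R)] V)
  (hyx : ∀ v, y (x v) = t • v) (hxy : ∀ v, x (y v) = σ t • v)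

theorem moduleOf_incl (r : R) (v : V) :
    letI := moduleOf x y hyx hxy
    incl σ t r • v = r • v := by
  change rep x y hyx hxy (incl σ t r) v = _
  unfold rep
  erw [RingQuot.lift_mkRingHom_apply]
  rw [RingHom.coe_coe, FreeAlgebra.lift_ι_apply]
  rfl

theorem moduleOf_X (v : V) :
    letI := moduleOf x y hyx hxy
    X σ t • v = x v := by
  change rep x y hyx hxy (X σ t) v = _
  unfold rep
  erw [RingQuot.lift_mkRingHom_apply]
  rw [RingHom.coe_coe, FreeAlgebra.lift_ι_apply]
  rfl

theorem moduleOf_Y (v : V) :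
    letI := moduleOf x y hyx hxy
    Y σ t • v = y v := by
  change rep x y hyx hxy (Y σ t) v = _
  unfold rep
  erw [RingQuot.lift_mkRingHom_apply]
  rw [RingHom.coe_coe, FreeAlgebra.lift_ι_apply]
  rfl

theorem moduleOf_tower :
    letI := moduleOf x y hyx hxy
    IsScalarTower R (GWA σ t) V := by
  let := moduleOf x y hyx hxy
  refine ⟨fun r a v => ?_⟩
  rw [smul_def, mul_smul, moduleOf_incl x y hyx hxy]

end ofAction

end GWA

/-! ### Weight modules -/

section weight
variable (R : Type) [CommRing R] (V W : Type) [AddCommGroup V] [Module R V]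
  [AddCommGroup W] [Module R W]

/-- The weight space `V_𝔪 = {v | 𝔪 v = 0}`. -/
abbrev weightSpace (m : MaximalSpectrum R) : Submodule R V :=
  Submodule.torsionBySet R V (m.asIdeal : Set R)

open Classical in
/-- `V` is the direct sum of its weight spaces. -/
def IsWeight : Prop := DirectSum.IsInternal (weightSpace R V)

/-- `V` is a weight module with support in `ω` and finite-dimensional weight spaces. -/
structure IsFinWeightOn (ω : Set (MaximalSpectrum R)) : Prop where
  isWeight : IsWeight R V
  finite : ∀ m : MaximalSpectrum R, Module.Finite (R ⧸ m.asIdeal) (weightSpace R V m)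
  supp : ∀ m : MaximalSpectrum R, weightSpace R V m ≠ ⊥ → m ∈ ω

variable {R V W}

theorem weightSpace_indep : iSupIndep (weightSpace R V) := by
  classical
  rw [iSupIndep_iff_supIndep]
  intro s
  exact Submodule.supIndep_torsionBySet_ideal (p := fun m : MaximalSpectrum R => m.asIdeal)
    fun i _ j _ hij => Ideal.isCoprime_iff_sup_eq.mp
      (Ideal.isCoprime_of_isMaximal fun h => hij (MaximalSpectrum.ext h))

theorem isWeight_iff : IsWeight R V ↔ ⨆ m, weightSpace R V m = ⊤ := by
  classical
  unfold IsWeight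
  rw [DirectSum.isInternal_submodule_iff_iSupIndep_and_iSup_eq_top]
  exact ⟨fun h => h.2, fun h => ⟨weightSpace_indep, h⟩⟩

theorem IsWeight.isSemisimpleModule (h : IsWeight R V) : IsSemisimpleModule R V := by
  refine isSemisimpleModule_of_isSemisimpleModule_submodule' (p := weightSpace R V) (fun m => ?_)
    (isWeight_iff.mp h)
  let := Ideal.Quotient.field m.asIdeal
  have : IsSemisimpleModule (R ⧸ m.asIdeal) (weightSpace R V m) := inferInstance
  exact (LinearMap.isSemisimpleModule_iff_of_bijective
    (σ := Ideal.Quotient.mk m.asIdeal)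
    { toFun := id, map_add' := fun _ _ => rfl, map_smul' := fun _ _ => rfl }
    Function.bijective_id).mpr this

/-- Subspaces of the weight spaces that span a weight module are the weight spaces. -/
theorem weightSpace_eq (P : MaximalSpectrum R → Submodule R V) (hP : ∀ m, P m ≤ weightSpace R V m)
    (h : ⨆ m, P m = ⊤) (m : MaximalSpectrum R) : weightSpace R V m = P m := by
  refine le_antisymm (fun v hv => ?_) (hP m)
  have hv' : v ∈ P m ⊔ ⨆ (j) (_ : j ≠ m), P j := by
    have : v ∈ (⊤ : Submodule R V) := trivial
    rw [← h] at this
    refine (iSup_le fun j => ?_ : ⨆ j, P j ≤ P m ⊔ ⨆ (j) (_ : j ≠ m), P j) this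
    by_cases hj : j = m
    · subst hj; exact le_sup_left
    · exact le_sup_of_le_right (le_iSup₂_of_le j hj le_rfl)
  obtain ⟨a, ha, b, hb, rfl⟩ := Submodule.mem_sup.mp hv'
  have hb1 : b ∈ weightSpace R V m := by
    simpa using Submodule.sub_mem _ hv (hP m ha)
  have hb2 : b ∈ ⨆ (j) (_ : j ≠ m), weightSpace R V j :=
    iSup₂_mono (fun j _ => hP j) hb
  have : b = 0 := Submodule.disjoint_def.mp (weightSpace_indep m) b hb1 hb2
  simpa [this] using ha

theorem finite_quot_iff (m : MaximalSpectrum R) :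
    Module.Finite (R ⧸ m.asIdeal) (weightSpace R V m) ↔ Module.Finite R (weightSpace R V m) := by
  constructor
  · intro h
    exact Module.Finite.trans (R ⧸ m.asIdeal) _
  · intro h
    exact Module.Finite.of_restrictScalars_finite R _ _

/-- The weight spaces of a tensor product. -/
def tensorWeight (R : Type) [CommRing R] (V W : Type) [AddCommGroup V] [Module R V]
    [AddCommGroup W] [Module R W] (m : MaximalSpectrum R) : Submodule R (V ⊗[R] W) :=
  LinearMap.range (TensorProduct.map (weightSpace R V m).subtype (weightSpace R W m).subtype)

theorem tensorWeight_le (m : MaximalSpectrum R) :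
    tensorWeight R V W m ≤ weightSpace R (V ⊗[R] W) m := by
  rintro _ ⟨x, rfl⟩
  rw [Submodule.mem_torsionBySet_iff]
  rintro ⟨a, ha⟩
  induction x with
  | zero => simp
  | add x y hx hy => rw [map_add, smul_add, hx, hy, add_zero]
  | tmul x y =>
    have : a • (x : V) = 0 := ((Submodule.mem_torsionBySet_iff _ _).mp x.2) ⟨a, ha⟩
    simp [TensorProduct.smul_tmul', this]

theorem iSup_tensorWeight (hV : IsWeight R V) (hW : IsWeight R W) :
    ⨆ m, tensorWeight R V W m = ⊤ := by
  rw [eq_top_iff]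
  rintro x -
  induction x with
  | zero => exact zero_mem _
  | add x y hx hy => exact add_mem hx hy
  | tmul v w =>
    have hv : v ∈ ⨆ m, weightSpace R V m := by rw [isWeight_iff.mp hV]; trivial
    have hw : w ∈ ⨆ m, weightSpace R W m := by rw [isWeight_iff.mp hW]; trivial
    induction hv using Submodule.iSup_induction' with
    | zero => simp
    | add x y _ _ hx hy => rw [TensorProduct.add_tmul]; exact add_mem hx hy
    | mem i v hv =>
      induction hw using Submodule.iSup_induction' with
      | zero => simp
      | add x y _ _ hx hy => rw [TensorProduct.tmul_add]; exact add_mem hx hy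
      | mem j w hw =>
        by_cases hij : i = j
        · subst hij
          exact Submodule.mem_iSup_of_mem i ⟨(⟨v, hv⟩ : weightSpace R V i) ⊗ₜ
            (⟨w, hw⟩ : weightSpace R W i), by simp⟩
        · have hc : IsCoprime i.asIdeal j.asIdeal :=
            Ideal.isCoprime_of_isMaximal fun h => hij (MaximalSpectrum.ext h)
          obtain ⟨a, ha, b, hb, hab⟩ := Ideal.isCoprime_iff_exists.mp hc
          have h1 : a • v = 0 := (Submodule.mem_torsionBySet_iff _ _).mp hv ⟨a, ha⟩
          have h2 : b • w = 0 := (Submodule.mem_torsionBySet_iff _ _).mp hw ⟨b, hb⟩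
          have : v ⊗ₜ[R] w = 0 := by
            rw [← one_smul R (v ⊗ₜ[R] w), ← hab, add_smul, TensorProduct.smul_tmul', h1,
              TensorProduct.zero_tmul, TensorProduct.smul_tmul', TensorProduct.smul_tmul, h2,
              TensorProduct.tmul_zero, add_zero]
          rw [this]; exact zero_mem _

theorem IsFinWeightOn.tensor {ω : Set (MaximalSpectrum R)} (hV : IsFinWeightOn R V ω)
    (hW : IsFinWeightOn R W ω) : IsFinWeightOn R (V ⊗[R] W) ω := by
  have hsup := iSup_tensorWeight hV.isWeight hW.isWeight
  have heq := weightSpace_eq _ tensorWeight_le hsup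
  refine ⟨isWeight_iff.mpr ?_, fun m => ?_, fun m hm => hV.supp m fun h => hm ?_⟩
  · rw [eq_top_iff, ← hsup]; exact iSup_mono tensorWeight_le
  · rw [finite_quot_iff, heq m]
    have := (finite_quot_iff m).mp (hV.finite m)
    have := (finite_quot_iff m).mp (hW.finite m)
    unfold tensorWeight
    infer_instance
  · rw [heq m, eq_bot_iff]
    rintro _ ⟨x, rfl⟩
    induction x with
    | zero => simp
    | add x y hx hy => rw [map_add]; exact add_mem hx hy
    | tmul x y =>
      have : (x : V) = 0 := by simpa [h] using x.2
      simp [this]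

theorem IsFinWeightOn.of_subsingleton [Subsingleton V] (ω : Set (MaximalSpectrum R)) :
    IsFinWeightOn R V ω :=
  ⟨isWeight_iff.mpr (Subsingleton.elim _ _), fun _ => inferInstance,
    fun _ h => (h (Subsingleton.elim _ _)).elim⟩

/-- The module `R ⧸ ⋂ ω ≅ ⨁_{𝔪 ∈ ω} R ⧸ 𝔪`, for a finite set `ω` of maximal ideals. -/
theorem IsFinWeightOn.quot {ω : Set (MaximalSpectrum R)} (hω : ω.Finite) :
    IsFinWeightOn R (R ⧸ ⨅ m ∈ ω, m.asIdeal) ω := by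
  have h0 : ⨆ m ∈ ω, weightSpace R (R ⧸ ⨅ m ∈ ω, m.asIdeal) m = ⊤ := by
    have := Submodule.iSup_torsionBySet_ideal_eq_torsionBySet_iInf
      (M := R ⧸ ⨅ m ∈ ω, m.asIdeal) (S := hω.toFinset)
      (p := fun m : MaximalSpectrum R => m.asIdeal)
      fun i _ j _ hij => Ideal.isCoprime_iff_sup_eq.mp
      (Ideal.isCoprime_of_isMaximal fun h => hij (MaximalSpectrum.ext h))
    simp only [Set.Finite.mem_toFinset] at this
    rw [this, eq_top_iff]
    rintro x -
    rw [Submodule.mem_torsionBySet_iff]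
    rintro ⟨a, ha⟩
    obtain ⟨x, rfl⟩ := Ideal.Quotient.mk_surjective x
    change Ideal.Quotient.mk _ (a * x) = 0
    rw [Ideal.Quotient.eq_zero_iff_mem]
    exact Ideal.mul_mem_right _ _ ha
  have hw : IsWeight R (R ⧸ ⨅ m ∈ ω, m.asIdeal) := by
    rw [isWeight_iff, eq_top_iff, ← h0]
    exact iSup_mono fun m => iSup_le fun _ => le_rfl
  have := hw.isSemisimpleModule
  refine ⟨hw, fun m => ?_, fun m hm => ?_⟩
  · rw [finite_quot_iff]
    infer_instance
  · by_contra hmω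
    refine hm (disjoint_self.mp ((weightSpace_indep (R := R) m).mono_right ?_))
    refine le_trans le_top ?_
    rw [← h0]
    exact iSup_mono fun j => iSup_le fun hj => le_iSup_of_le (by rintro rfl; exact hmω hj) le_rfl

/-- An injective `R`-linear map into a weight module splits. -/
theorem IsWeight.exists_retraction (h : IsWeight R W) (f : V →ₗ[R] W)
    (hf : Function.Injective f) : ∃ g : W →ₗ[R] V, g ∘ₗ f = LinearMap.id := by
  have := h.isSemisimpleModule
  exact IsSemisimpleModule.extension_property f hf LinearMap.id

end weight

section category
variable {R : Type} [CommRing R]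

/-- `ω` is a finite orbit of maximal ideals under the action of `σ`. -/
class IsFiniteOrbit (σ : R ≃+* R) (ω : Set (MaximalSpectrum R)) : Prop where
  finite : ω.Finite
  orbit : ∃ m₀ ∈ ω, ω = {m | ∃ n : ℤ, m.asIdeal = m₀.asIdeal.map (σ ^ n : R ≃+* R)}

/-- Objects of `A(t)-wmod_ω`: weight modules over `A(t)` with finite-dimensional weight spaces and
support in `ω`. The `R`-module structure is the restriction of the `A(t)`-module structure.
Morphisms are the `A(t)`-linear maps. -/
structure WMod (σ : R ≃+* R) (ω : Set (MaximalSpectrum R)) (t : R) where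
  carrier : Type
  [addCommGroup : AddCommGroup carrier]
  [moduleBase : Module R carrier]
  [module : Module (GWA σ t) carrier]
  [tower : IsScalarTower R (GWA σ t) carrier]
  isFinWeightOn : IsFinWeightOn R carrier ω

namespace WMod

variable {σ : R ≃+* R} {ω : Set (MaximalSpectrum R)} {t t' : R}

instance : CoeSort (WMod σ ω t) Type := ⟨WMod.carrier⟩

attribute [instance] addCommGroup moduleBase module tower

/-- The zero module. -/
def zero (σ : R ≃+* R) (ω : Set (MaximalSpectrum R)) (t : R) : WMod σ ω t :=
  letI : Module (GWA σ t) PUnit.{1} := inferInstance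
  haveI : IsScalarTower R (GWA σ t) PUnit.{1} := ⟨fun _ _ _ => rfl⟩
  { carrier := PUnit.{1}
    isFinWeightOn := .of_subsingleton ω }

/-- The tensor product `M ⊗_R N` of an `A(t)`-module and an `A(t')`-module, as a module over
`A(t t')`: here `X` acts by `X ⊗ X` and `Y` acts by `Y ⊗ Y`. -/
def tensor (M : WMod σ ω t) (N : WMod σ ω t') : WMod σ ω (t * t') :=
  letI x : (M ⊗[R] N) →ₛₗ[(σ : R →+* R)] (M ⊗[R] N) :=
    TensorProduct.map (GWA.actX σ t) (GWA.actX σ t')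
  letI y : (M ⊗[R] N) →ₛₗ[(σ.symm : R →+* R)] (M ⊗[R] N) :=
    TensorProduct.map (GWA.actY σ t) (GWA.actY σ t')
  have hyx : ∀ v, y (x v) = (t * t') • v := fun v => by
    induction v with
    | zero => simp
    | add a b ha hb => rw [map_add, map_add, ha, hb, smul_add]
    | tmul a b =>
      simp only [x, y, TensorProduct.map_tmul, GWA.actY_actX, TensorProduct.smul_tmul_smul]
  have hxy : ∀ v, x (y v) = σ (t * t') • v := fun v => by
    induction v with
    | zero => simp
    | add a b ha hb => rw [map_add, map_add, ha, hb, smul_add]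
    | tmul a b =>
      simp only [x, y, TensorProduct.map_tmul, GWA.actX_actY, TensorProduct.smul_tmul_smul, map_mul]
  { carrier := M ⊗[R] N
    module := GWA.moduleOf x y hyx hxy
    tower := GWA.moduleOf_tower x y hyx hxy
    isFinWeightOn := M.isFinWeightOn.tensor N.isFinWeightOn }

/-- The action of `X` on `M`. -/
def actX (M : WMod σ ω t) : M →ₛₗ[(σ : R →+* R)] M := GWA.actX σ t

/-- The action of `Y` on `M`. -/
def actY (M : WMod σ ω t) : M →ₛₗ[(σ.symm : R →+* R)] M := GWA.actY σ t

theorem tensor_X (M : WMod σ ω t) (N : WMod σ ω t') (v : M ⊗[R] N) :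
    (tensor M N).actX v = TensorProduct.map M.actX N.actX v :=
  GWA.moduleOf_X (V := M ⊗[R] N) ..

theorem tensor_Y (M : WMod σ ω t) (N : WMod σ ω t') (v : M ⊗[R] N) :
    (tensor M N).actY v = TensorProduct.map M.actY N.actY v :=
  GWA.moduleOf_Y (V := M ⊗[R] N) ..

theorem smul_eq_zero (M : WMod σ ω t) {a : R} (ha : a ∈ ⨅ m ∈ ω, m.asIdeal) (v : M) :
    a • v = 0 := by
  have hv : v ∈ ⨆ m, weightSpace R M m := by
    rw [isWeight_iff.mp M.isFinWeightOn.isWeight]; trivial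
  induction hv using Submodule.iSup_induction' with
  | zero => simp
  | add x y _ _ hx hy => rw [smul_add, hx, hy, add_zero]
  | mem m v hv =>
    by_cases h0 : weightSpace R M m = ⊥
    · rw [h0] at hv; simp [(Submodule.mem_bot R).mp hv]
    · have hm := M.isFinWeightOn.supp m h0
      simp only [Ideal.mem_iInf] at ha
      exact (Submodule.mem_torsionBySet_iff _ _).mp hv ⟨a, ha m hm⟩

section unit

variable (σ : R ≃+* R) (ω : Set (MaximalSpectrum R)) [h : IsFiniteOrbit σ ω]

theorem mem_iInf_orbit (n : ℤ) {a : R} (ha : a ∈ ⨅ m ∈ ω, m.asIdeal) :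
    (σ ^ n : R ≃+* R) a ∈ ⨅ m ∈ ω, m.asIdeal := by
  obtain ⟨m₀, -, hω⟩ := h.orbit
  simp only [Ideal.mem_iInf] at ha ⊢
  intro m hm
  obtain ⟨k, hk⟩ : ∃ n : ℤ, m.asIdeal = m₀.asIdeal.map (σ ^ n : R ≃+* R) := by
    rw [hω] at hm; exact hm
  let m' : MaximalSpectrum R := ⟨m₀.asIdeal.map (σ ^ (k - n) : R ≃+* R),
    Ideal.map_isMaximal_of_equiv _⟩
  have hm' : m' ∈ ω := by rw [hω]; exact ⟨_, rfl⟩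
  have h1 := ha m' hm'
  obtain ⟨b, hb, rfl⟩ := (Ideal.mem_map_of_equiv _ _).mp h1
  rw [hk]
  refine (Ideal.mem_map_of_equiv _ _).mpr ⟨b, hb, ?_⟩
  rw [← RingAut.mul_apply, ← zpow_add]
  congr 2
  ring

/-- The unit object `R ⧸ ⋂ ω ≅ ⨁_{𝔪 ∈ ω} R ⧸ 𝔪` over `A(1)`: here `X` acts by `σ` and `Y` acts
by `σ⁻¹`. -/
def unit : WMod σ ω 1 :=
  letI I : Ideal R := ⨅ m ∈ ω, m.asIdeal
  letI x : (R ⧸ I) →ₛₗ[(σ : R →+* R)] (R ⧸ I) :=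
    { toFun := Ideal.quotientMap I (σ : R →+* R) fun a ha => by
        exact mem_iInf_orbit σ ω 1 ha
      map_add' := map_add _
      map_smul' := fun r v => by
        obtain ⟨v, rfl⟩ := Ideal.Quotient.mk_surjective v
        exact congrArg (Ideal.Quotient.mk I) (map_mul σ r v) }
  letI y : (R ⧸ I) →ₛₗ[(σ.symm : R →+* R)] (R ⧸ I) :=
    { toFun := Ideal.quotientMap I (σ.symm : R →+* R) fun a ha => by
        exact mem_iInf_orbit σ ω (-1) ha
      map_add' := map_add _
      map_smul' := fun r v => by
        obtain ⟨v, rfl⟩ := Ideal.Quotient.mk_surjective v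
        exact congrArg (Ideal.Quotient.mk I) (map_mul σ.symm r v) }
  have hyx : ∀ v, y (x v) = (1 : R) • v := fun v => by
    obtain ⟨v, rfl⟩ := Ideal.Quotient.mk_surjective v
    rw [one_smul]
    exact congrArg (Ideal.Quotient.mk I) (σ.symm_apply_apply v)
  have hxy : ∀ v, x (y v) = σ (1 : R) • v := fun v => by
    obtain ⟨v, rfl⟩ := Ideal.Quotient.mk_surjective v
    rw [map_one, one_smul]
    exact congrArg (Ideal.Quotient.mk I) (σ.apply_symm_apply v)
  { carrier := R ⧸ I
    module := GWA.moduleOf x y hyx hxy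
    tower := GWA.moduleOf_tower x y hyx hxy
    isFinWeightOn := .quot h.finite }

theorem unit_X (a : R) : (unit σ ω).actX (Ideal.Quotient.mk (⨅ m ∈ ω, m.asIdeal) a) =
    (Ideal.Quotient.mk _ (σ a) : unit σ ω) :=
  GWA.moduleOf_X (V := R ⧸ ⨅ m ∈ ω, m.asIdeal) ..

theorem unit_Y (a : R) : (unit σ ω).actY (Ideal.Quotient.mk (⨅ m ∈ ω, m.asIdeal) a) =
    (Ideal.Quotient.mk _ (σ.symm a) : unit σ ω) :=
  GWA.moduleOf_Y (V := R ⧸ ⨅ m ∈ ω, m.asIdeal) ..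

end unit

section unit

variable [h : IsFiniteOrbit σ ω]

/-- The left unit isomorphism. -/
def unitTensor (M : WMod σ ω t) : (tensor (unit σ ω) M) ≃ₗ[R] M :=
  (TensorProduct.quotTensorEquivQuotSMul M (⨅ m ∈ ω, m.asIdeal)).trans
    (Submodule.quotEquivOfEqBot _ (by
      rw [eq_bot_iff, Submodule.smul_le]
      intro a ha v _
      exact (Submodule.mem_bot R).mpr (smul_eq_zero M ha v)))

theorem unitTensor_tmul (M : WMod σ ω t) (a : R) (v : M) :
    unitTensor M (Ideal.Quotient.mk (⨅ m ∈ ω, m.asIdeal) a ⊗ₜ[R] v) = a • v := by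
  rfl

end unit

end WMod
end category

section groth
variable {R : Type} [CommRing R]

/-- The two kinds of Grothendieck group: with relations from all short exact sequences, or only
from direct sum decompositions. -/
inductive K0Kind
  | all
  | split

variable {σ : R ≃+* R} {ω : Set (MaximalSpectrum R)} {t t' : R}

/-- `[M] = [M'] + [M'']` is a defining relation of the Grothendieck group: for the ordinary one, if
there is a short exact sequence `0 → M' → M → M'' → 0`, and for the split one, if
`M ≅ M' ⊕ M''`. -/
def K0Rel : K0Kind → WMod σ ω t → WMod σ ω t → WMod σ ω t → Prop
  | .all, M', M, M'' => ∃ (f : M' →ₗ[GWA σ t] M) (g : M →ₗ[GWA σ t] M''),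
      Function.Injective f ∧ Function.Exact f g ∧ Function.Surjective g
  | .split, M', M, M'' => Nonempty (M ≃ₗ[GWA σ t] M' × M'')

theorem K0Rel.ofSplit {M' M M'' : WMod σ ω t} (h : K0Rel .split M' M M'') (k : K0Kind) :
    K0Rel k M' M M'' := by
  cases k with
  | split => exact h
  | all =>
    obtain ⟨e⟩ := h
    refine ⟨e.symm.toLinearMap ∘ₗ LinearMap.inl _ _ _, LinearMap.snd _ _ _ ∘ₗ e.toLinearMap,
      ?_, ?_, ?_⟩
    · exact e.symm.injective.comp LinearMap.inl_injective
    · intro x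
      constructor
      · intro hx
        exact ⟨(e x).1, by
          apply e.injective
          simp only [LinearMap.comp_apply, LinearEquiv.coe_coe, LinearEquiv.apply_symm_apply]
          exact Prod.ext rfl (by simpa using hx.symm)⟩
      · rintro ⟨y, rfl⟩
        simp
    · exact (LinearMap.snd_surjective (R := GWA σ t) (M := M') (M₂ := M'')).comp e.surjective

theorem restrict_X {A B : WMod σ ω t} (f : A →ₗ[GWA σ t] B) (v : A) :
    GWA.restrict σ t f (A.actX v) = B.actX (GWA.restrict σ t f v) := map_smul f _ _

theorem restrict_Y {A B : WMod σ ω t} (f : A →ₗ[GWA σ t] B) (v : A) :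
    GWA.restrict σ t f (A.actY v) = B.actY (GWA.restrict σ t f v) := map_smul f _ _

theorem exists_rTensor {A B : WMod σ ω t} (f : A →ₗ[GWA σ t] B) (N : WMod σ ω t') :
    ∃ F : (A.tensor N) →ₗ[GWA σ (t * t')] (B.tensor N),
      ⇑F = ⇑(LinearMap.rTensor N (GWA.restrict σ t f)) := by
  let F₀ : (A.tensor N) →ₗ[R] (B.tensor N) := LinearMap.rTensor N (GWA.restrict σ t f)
  have hX : ∀ v : A ⊗[R] N, LinearMap.rTensor N (GWA.restrict σ t f)
      (TensorProduct.map A.actX N.actX v) =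
      TensorProduct.map B.actX N.actX (LinearMap.rTensor N (GWA.restrict σ t f) v) := fun v => by
    induction v with
    | zero => simp
    | add a b ha hb => simp only [map_add, ha, hb]
    | tmul a b => simp [restrict_X]
  have hY : ∀ v : A ⊗[R] N, LinearMap.rTensor N (GWA.restrict σ t f)
      (TensorProduct.map A.actY N.actY v) =
      TensorProduct.map B.actY N.actY (LinearMap.rTensor N (GWA.restrict σ t f) v) := fun v => by
    induction v with
    | zero => simp
    | add a b ha hb => simp only [map_add, ha, hb]
    | tmul a b => simp [restrict_Y]
  exact ⟨GWA.linearMapOf F₀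
    (fun v => (congrArg F₀ (WMod.tensor_X A N v)).trans ((hX v).trans (WMod.tensor_X B N _).symm))
    (fun v => (congrArg F₀ (WMod.tensor_Y A N v)).trans ((hY v).trans (WMod.tensor_Y B N _).symm)),
    rfl⟩

theorem exists_lTensor {A B : WMod σ ω t} (f : A →ₗ[GWA σ t] B) (N : WMod σ ω t') :
    ∃ F : (N.tensor A) →ₗ[GWA σ (t' * t)] (N.tensor B),
      ⇑F = ⇑(LinearMap.lTensor N (GWA.restrict σ t f)) := by
  let F₀ : (N.tensor A) →ₗ[R] (N.tensor B) := LinearMap.lTensor N (GWA.restrict σ t f)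
  have hX : ∀ v : N ⊗[R] A, LinearMap.lTensor N (GWA.restrict σ t f)
      (TensorProduct.map N.actX A.actX v) =
      TensorProduct.map N.actX B.actX (LinearMap.lTensor N (GWA.restrict σ t f) v) := fun v => by
    induction v with
    | zero => simp
    | add a b ha hb => simp only [map_add, ha, hb]
    | tmul a b => simp [restrict_X]
  have hY : ∀ v : N ⊗[R] A, LinearMap.lTensor N (GWA.restrict σ t f)
      (TensorProduct.map N.actY A.actY v) =
      TensorProduct.map N.actY B.actY (LinearMap.lTensor N (GWA.restrict σ t f) v) := fun v => by
    induction v with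
    | zero => simp
    | add a b ha hb => simp only [map_add, ha, hb]
    | tmul a b => simp [restrict_Y]
  exact ⟨GWA.linearMapOf F₀
    (fun v => (congrArg F₀ (WMod.tensor_X N A v)).trans ((hX v).trans (WMod.tensor_X N B _).symm))
    (fun v => (congrArg F₀ (WMod.tensor_Y N A v)).trans ((hY v).trans (WMod.tensor_Y N B _).symm)),
    rfl⟩

/-- An `A(t)`-linear decomposition is `R`-linear. -/
def restrictProd {M' M M'' : WMod σ ω t} (e : M ≃ₗ[GWA σ t] M' × M'') : M ≃ₗ[R] M' × M'' :=
  { (GWA.restrict σ t (LinearMap.fst _ _ _ ∘ₗ e.toLinearMap)).prod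
      (GWA.restrict σ t (LinearMap.snd _ _ _ ∘ₗ e.toLinearMap)) with
    invFun := e.symm
    left_inv := e.left_inv
    right_inv := e.right_inv }

theorem K0Rel.tensor_right {k : K0Kind} {M' M M'' : WMod σ ω t} (h : K0Rel k M' M M'')
    (N : WMod σ ω t') : K0Rel k (M'.tensor N) (M.tensor N) (M''.tensor N) := by
  cases k with
  | all =>
    obtain ⟨f, g, hf, hfg, hg⟩ := h
    obtain ⟨F, hF⟩ := exists_rTensor f N
    obtain ⟨G, hG⟩ := exists_rTensor g N
    refine ⟨F, G, ?_, ?_, ?_⟩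
    · obtain ⟨r, hr⟩ := M.isFinWeightOn.isWeight.exists_retraction (GWA.restrict σ t f) hf
      rw [hF]
      refine Function.LeftInverse.injective (g := LinearMap.rTensor N r) fun x => ?_
      rw [← LinearMap.comp_apply, ← LinearMap.rTensor_comp, hr, LinearMap.rTensor_id]; rfl
    · rw [hF, hG]
      exact rTensor_exact N (f := GWA.restrict σ t f) (g := GWA.restrict σ t g) hfg hg
    · rw [hG]
      exact LinearMap.rTensor_surjective N (g := GWA.restrict σ t g) hg
  | split =>
    obtain ⟨e⟩ := h
    obtain ⟨F, hF⟩ := exists_rTensor (LinearMap.fst _ _ _ ∘ₗ e.toLinearMap) N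
    obtain ⟨G, hG⟩ := exists_rTensor (LinearMap.snd _ _ _ ∘ₗ e.toLinearMap) N
    refine ⟨LinearEquiv.ofBijective (F.prod G) ?_⟩
    let E := (LinearEquiv.rTensor N (restrictProd e)).trans (TensorProduct.prodLeft R R M' M'' N)
    have hE : ∀ x : M ⊗[R] N, (LinearMap.rTensor N
          (GWA.restrict σ t (LinearMap.fst _ _ _ ∘ₗ e.toLinearMap)) x,
        LinearMap.rTensor N
          (GWA.restrict σ t (LinearMap.snd _ _ _ ∘ₗ e.toLinearMap)) x) = E x := by
      intro x
      induction x with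
      | zero => simp
      | add a b ha hb => rw [map_add, map_add, map_add, ← ha, ← hb]; rfl
      | tmul a b => rfl
    have : ⇑(F.prod G) = ⇑E := by
      funext x
      rw [← hE x]
      exact Prod.ext (congrFun hF x) (congrFun hG x)
    rw [this]
    exact E.bijective

theorem K0Rel.tensor_left {k : K0Kind} {M' M M'' : WMod σ ω t} (h : K0Rel k M' M M'')
    (N : WMod σ ω t') : K0Rel k (N.tensor M') (N.tensor M) (N.tensor M'') := by
  cases k with
  | all =>
    obtain ⟨f, g, hf, hfg, hg⟩ := h
    obtain ⟨F, hF⟩ := exists_lTensor f N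
    obtain ⟨G, hG⟩ := exists_lTensor g N
    refine ⟨F, G, ?_, ?_, ?_⟩
    · obtain ⟨r, hr⟩ := M.isFinWeightOn.isWeight.exists_retraction (GWA.restrict σ t f) hf
      rw [hF]
      refine Function.LeftInverse.injective (g := LinearMap.lTensor N r) fun x => ?_
      rw [← LinearMap.comp_apply, ← LinearMap.lTensor_comp, hr, LinearMap.lTensor_id]; rfl
    · rw [hF, hG]
      exact lTensor_exact N (f := GWA.restrict σ t f) (g := GWA.restrict σ t g) hfg hg
    · rw [hG]
      exact LinearMap.lTensor_surjective N (g := GWA.restrict σ t g) hg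
  | split =>
    obtain ⟨e⟩ := h
    obtain ⟨F, hF⟩ := exists_lTensor (LinearMap.fst _ _ _ ∘ₗ e.toLinearMap) N
    obtain ⟨G, hG⟩ := exists_lTensor (LinearMap.snd _ _ _ ∘ₗ e.toLinearMap) N
    refine ⟨LinearEquiv.ofBijective (F.prod G) ?_⟩
    let E := (LinearEquiv.lTensor N (restrictProd e)).trans (TensorProduct.prodRight R R N M' M'')
    have hE : ∀ x : N ⊗[R] M, (LinearMap.lTensor N
          (GWA.restrict σ t (LinearMap.fst _ _ _ ∘ₗ e.toLinearMap)) x,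
        LinearMap.lTensor N
          (GWA.restrict σ t (LinearMap.snd _ _ _ ∘ₗ e.toLinearMap)) x) = E x := by
      intro x
      induction x with
      | zero => simp
      | add a b ha hb => rw [map_add, map_add, map_add, ← ha, ← hb]; rfl
      | tmul a b => rfl
    have : ⇑(F.prod G) = ⇑E := by
      funext x
      rw [← hE x]
      exact Prod.ext (congrFun hF x) (congrFun hG x)
    rw [this]
    exact E.bijective

theorem K0Rel.ofEquiv (k : K0Kind) {M N : WMod σ ω t} (e : M ≃ₗ[GWA σ t] N) :
    K0Rel k N M (WMod.zero σ ω t) := by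
  let : Unique (WMod.zero σ ω t) := inferInstanceAs (Unique PUnit.{1})
  exact K0Rel.ofSplit ⟨e.trans (LinearEquiv.prodUnique (R := GWA σ t) (M := N)
    (M₂ := WMod.zero σ ω t)).symm⟩ k

/-! ### Grothendieck groups -/

/-- The defining relations of the Grothendieck group. -/
def K0Relations (k : K0Kind) (σ : R ≃+* R) (ω : Set (MaximalSpectrum R)) (t : R) :
    AddSubgroup (FreeAbelianGroup (WMod σ ω t)) :=
  AddSubgroup.closure {x | ∃ M' M M'' : WMod σ ω t, K0Rel k M' M M'' ∧
    x = FreeAbelianGroup.of M - (FreeAbelianGroup.of M' + FreeAbelianGroup.of M'')}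

/-- The Grothendieck group (`k = .all`) or the split Grothendieck group (`k = .split`) of
`A(t)-wmod_ω`. -/
def K0 (k : K0Kind) (σ : R ≃+* R) (ω : Set (MaximalSpectrum R)) (t : R) : Type 1 :=
  FreeAbelianGroup (WMod σ ω t) ⧸ K0Relations k σ ω t

namespace K0

variable {k : K0Kind}

instance : AddCommGroup (K0 k σ ω t) :=
  inferInstanceAs (AddCommGroup (FreeAbelianGroup (WMod σ ω t) ⧸ K0Relations k σ ω t))

/-- The class of a module. -/
def cls (k : K0Kind) (M : WMod σ ω t) : K0 k σ ω t :=
  QuotientAddGroup.mk' (K0Relations k σ ω t) (FreeAbelianGroup.of M)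

theorem cls_rel {M' M M'' : WMod σ ω t} (h : K0Rel k M' M M'') :
    cls k M = cls k M' + cls k M'' := by
  have : QuotientAddGroup.mk' (K0Relations k σ ω t) (FreeAbelianGroup.of M -
      (FreeAbelianGroup.of M' + FreeAbelianGroup.of M'')) = 0 :=
    (QuotientAddGroup.eq_zero_iff _).mpr (AddSubgroup.subset_closure ⟨M', M, M'', h, rfl⟩)
  rw [map_sub, map_add, sub_eq_zero] at this
  exact this

/-- The universal property of the Grothendieck group. -/
def lift {G : Type 1} [AddCommGroup G] (f : WMod σ ω t → G)
    (hf : ∀ M' M M'' : WMod σ ω t, K0Rel k M' M M'' → f M = f M' + f M'') : K0 k σ ω t →+ G :=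
  QuotientAddGroup.lift (K0Relations k σ ω t) (FreeAbelianGroup.lift f) (by
    unfold K0Relations
    rw [AddSubgroup.closure_le]
    rintro _ ⟨M', M, M'', h, rfl⟩
    simp [hf M' M M'' h])

theorem lift_cls {G : Type 1} [AddCommGroup G] (f : WMod σ ω t → G)
    (hf : ∀ M' M M'' : WMod σ ω t, K0Rel k M' M M'' → f M = f M' + f M'') (M : WMod σ ω t) :
    lift (k := k) f hf (cls k M) = f M :=
  FreeAbelianGroup.lift_apply_of f M

theorem induction {P : K0 k σ ω t → Prop} (h : ∀ M, P (cls k M)) (hneg : ∀ x, P x → P (-x))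
    (hadd : ∀ x y, P x → P y → P (x + y)) (x : K0 k σ ω t) : P x := by
  obtain ⟨x, rfl⟩ := QuotientAddGroup.mk'_surjective (K0Relations k σ ω t) x
  induction x using FreeAbelianGroup.induction_on with
  | zero =>
    have := hadd _ _ (h (WMod.zero σ ω t)) (hneg _ (h (WMod.zero σ ω t)))
    rw [add_neg_cancel] at this
    exact this
  | of M => exact h M
  | neg M hM => exact hneg _ hM
  | add x y hx hy => exact hadd _ _ hx hy

theorem cls_eq {M N : WMod σ ω t} (e : M ≃ₗ[GWA σ t] N) : cls k M = cls k N := by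
  have h0 := cls_rel (K0Rel.ofEquiv k (LinearEquiv.refl (GWA σ t) (WMod.zero σ ω t)))
  rw [cls_rel (K0Rel.ofEquiv k e), left_eq_add.mp h0, add_zero]

/-- The multiplication `[M] [N] = [M ⊗_R N]`. -/
def mul : K0 k σ ω t →ₗ[ℤ] K0 k σ ω t' →ₗ[ℤ] K0 k σ ω (t * t') :=
  (lift (fun M => (lift (fun N => cls k (M.tensor N))
      (fun _ _ _ h => cls_rel (h.tensor_left M))).toIntLinearMap)
    (fun M' M M'' h => by
      ext x
      induction x using K0.induction with
      | h N => simpa [lift_cls] using cls_rel (h.tensor_right N)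
      | hneg x hx => rw [map_neg, map_neg, hx]
      | hadd x y hx hy => rw [map_add, map_add, hx, hy])).toIntLinearMap

theorem mul_cls (M : WMod σ ω t) (N : WMod σ ω t') :
    mul (cls k M) (cls k N) = cls k (M.tensor N) := by
  simp [mul, lift_cls]

/-- The canonical map from the split Grothendieck group to the Grothendieck group. -/
def proj (σ : R ≃+* R) (ω : Set (MaximalSpectrum R)) (t : R) :
    K0 .split σ ω t →ₗ[ℤ] K0 .all σ ω t :=
  (lift (cls .all) fun _ _ _ h => cls_rel (h.ofSplit .all)).toIntLinearMap

theorem proj_cls (M : WMod σ ω t) : proj σ ω t (cls .split M) = cls .all M := by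
  simp [proj, lift_cls]

end K0

end groth

section ring
variable {R : Type} [CommRing R]

section coherence
variable {σ : R ≃+* R} {ω : Set (MaximalSpectrum R)} {t t' t'' : R}

theorem assoc_X (M : WMod σ ω t) (N : WMod σ ω t') (P : WMod σ ω t'') (v : (M ⊗[R] N) ⊗[R] P) :
    TensorProduct.assoc R M N P (((M.tensor N).tensor P).actX v) =
      (M.tensor (N.tensor P)).actX (TensorProduct.assoc R M N P v) := by
  have h : ∀ v : (M ⊗[R] N) ⊗[R] P,
      TensorProduct.assoc R M N P (TensorProduct.map (TensorProduct.map M.actX N.actX) P.actX v) =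
      TensorProduct.map M.actX (TensorProduct.map N.actX P.actX)
        (TensorProduct.assoc R M N P v) := fun v => by
    induction v with
    | zero => simp
    | add a b ha hb => simp only [map_add, ha, hb]
    | tmul a p =>
      induction a with
      | zero => simp
      | add a b ha hb => simp only [map_add, TensorProduct.add_tmul, ha, hb]
      | tmul a b => simp
  have h1 : ((M.tensor N).tensor P).actX v =
      TensorProduct.map (TensorProduct.map M.actX N.actX) P.actX v :=
    (WMod.tensor_X (M.tensor N) P v).trans
      (congrArg (fun f : M ⊗[R] N →ₛₗ[(σ : R →+* R)] M ⊗[R] N => TensorProduct.map f P.actX v)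
        (LinearMap.ext (WMod.tensor_X M N)))
  have h2 : ∀ w : M ⊗[R] (N ⊗[R] P), (M.tensor (N.tensor P)).actX w =
      TensorProduct.map M.actX (TensorProduct.map N.actX P.actX) w := fun w =>
    (WMod.tensor_X M (N.tensor P) w).trans
      (congrArg (fun f : N ⊗[R] P →ₛₗ[(σ : R →+* R)] N ⊗[R] P => TensorProduct.map M.actX f w)
        (LinearMap.ext (WMod.tensor_X N P)))
  exact (congrArg _ h1).trans ((h v).trans (h2 _).symm)

theorem comm_X (M : WMod σ ω t) (N : WMod σ ω t') (v : M ⊗[R] N) :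
    TensorProduct.comm R M N ((M.tensor N).actX v) =
      (N.tensor M).actX (TensorProduct.comm R M N v) := by
  have h : TensorProduct.comm R M N (TensorProduct.map M.actX N.actX v) =
      TensorProduct.map N.actX M.actX (TensorProduct.comm R M N v) := by
    induction v with
    | zero => simp
    | add a b ha hb => simp only [map_add, ha, hb]
    | tmul a b => simp
  exact (congrArg _ (WMod.tensor_X M N v)).trans (h.trans (WMod.tensor_X N M _).symm)

theorem assoc_Y (M : WMod σ ω t) (N : WMod σ ω t') (P : WMod σ ω t'') (v : (M ⊗[R] N) ⊗[R] P) :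
    TensorProduct.assoc R M N P (((M.tensor N).tensor P).actY v) =
      (M.tensor (N.tensor P)).actY (TensorProduct.assoc R M N P v) := by
  have h : ∀ v : (M ⊗[R] N) ⊗[R] P,
      TensorProduct.assoc R M N P (TensorProduct.map (TensorProduct.map M.actY N.actY) P.actY v) =
      TensorProduct.map M.actY (TensorProduct.map N.actY P.actY)
        (TensorProduct.assoc R M N P v) := fun v => by
    induction v with
    | zero => simp
    | add a b ha hb => simp only [map_add, ha, hb]
    | tmul a p =>
      induction a with
      | zero => simp
      | add a b ha hb => simp only [map_add, TensorProduct.add_tmul, ha, hb]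
      | tmul a b => simp
  have h1 : ((M.tensor N).tensor P).actY v =
      TensorProduct.map (TensorProduct.map M.actY N.actY) P.actY v :=
    (WMod.tensor_Y (M.tensor N) P v).trans
      (congrArg (fun f : M ⊗[R] N →ₛₗ[(σ.symm : R →+* R)] M ⊗[R] N => TensorProduct.map f P.actY v)
        (LinearMap.ext (WMod.tensor_Y M N)))
  have h2 : ∀ w : M ⊗[R] (N ⊗[R] P), (M.tensor (N.tensor P)).actY w =
      TensorProduct.map M.actY (TensorProduct.map N.actY P.actY) w := fun w =>
    (WMod.tensor_Y M (N.tensor P) w).trans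
      (congrArg (fun f : N ⊗[R] P →ₛₗ[(σ.symm : R →+* R)] N ⊗[R] P => TensorProduct.map M.actY f w)
        (LinearMap.ext (WMod.tensor_Y N P)))
  exact (congrArg _ h1).trans ((h v).trans (h2 _).symm)

theorem comm_Y (M : WMod σ ω t) (N : WMod σ ω t') (v : M ⊗[R] N) :
    TensorProduct.comm R M N ((M.tensor N).actY v) =
      (N.tensor M).actY (TensorProduct.comm R M N v) := by
  have h : TensorProduct.comm R M N (TensorProduct.map M.actY N.actY v) =
      TensorProduct.map N.actY M.actY (TensorProduct.comm R M N v) := by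
    induction v with
    | zero => simp
    | add a b ha hb => simp only [map_add, ha, hb]
    | tmul a b => simp
  exact (congrArg _ (WMod.tensor_Y M N v)).trans (h.trans (WMod.tensor_Y N M _).symm)

variable [IsFiniteOrbit σ ω]

theorem unit_X (M : WMod σ ω t) (v : ((WMod.unit σ ω).tensor M)) :
    WMod.unitTensor M (((WMod.unit σ ω).tensor M).actX v) =
      M.actX (WMod.unitTensor M v) := by
  let f : (R ⧸ ⨅ m ∈ ω, m.asIdeal) ⊗[R] M →ₗ[R] M := (WMod.unitTensor M).toLinearMap
  have hf : ∀ (a : R) (x : M), f (Ideal.Quotient.mk _ a ⊗ₜ[R] x) = a • x :=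
    WMod.unitTensor_tmul M
  let u : (R ⧸ ⨅ m ∈ ω, m.asIdeal) →ₛₗ[(σ : R →+* R)] (R ⧸ ⨅ m ∈ ω, m.asIdeal) :=
    (WMod.unit σ ω).actX
  have hu : ∀ a : R, u (Ideal.Quotient.mk _ a) = Ideal.Quotient.mk _ (σ a) :=
    WMod.unit_X σ ω
  have h : ∀ v : (R ⧸ ⨅ m ∈ ω, m.asIdeal) ⊗[R] M,
      f (TensorProduct.map u M.actX v) = M.actX (f v) := fun v => by
    induction v with
    | zero => simp
    | add a b ha hb => simp only [map_add, ha, hb]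
    | tmul a x =>
      obtain ⟨a, rfl⟩ := Ideal.Quotient.mk_surjective a
      rw [TensorProduct.map_tmul, hu, hf, hf, LinearMap.map_smulₛₗ]
      rfl
  exact (congrArg f (WMod.tensor_X (WMod.unit σ ω) M v)).trans (h v)

theorem unit_Y (M : WMod σ ω t) (v : ((WMod.unit σ ω).tensor M)) :
    WMod.unitTensor M (((WMod.unit σ ω).tensor M).actY v) =
      M.actY (WMod.unitTensor M v) := by
  let f : (R ⧸ ⨅ m ∈ ω, m.asIdeal) ⊗[R] M →ₗ[R] M := (WMod.unitTensor M).toLinearMap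
  have hf : ∀ (a : R) (x : M), f (Ideal.Quotient.mk _ a ⊗ₜ[R] x) = a • x :=
    WMod.unitTensor_tmul M
  let u : (R ⧸ ⨅ m ∈ ω, m.asIdeal) →ₛₗ[(σ.symm : R →+* R)] (R ⧸ ⨅ m ∈ ω, m.asIdeal) :=
    (WMod.unit σ ω).actY
  have hu : ∀ a : R, u (Ideal.Quotient.mk _ a) = Ideal.Quotient.mk _ (σ.symm a) :=
    WMod.unit_Y σ ω
  have h : ∀ v : (R ⧸ ⨅ m ∈ ω, m.asIdeal) ⊗[R] M,
      f (TensorProduct.map u M.actY v) = M.actY (f v) := fun v => by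
    induction v with
    | zero => simp
    | add a b ha hb => simp only [map_add, ha, hb]
    | tmul a x =>
      obtain ⟨a, rfl⟩ := Ideal.Quotient.mk_surjective a
      rw [TensorProduct.map_tmul, hu, hf, hf, LinearMap.map_smulₛₗ]
      rfl
  exact (congrArg f (WMod.tensor_Y (WMod.unit σ ω) M v)).trans (h v)

end coherence

/-- The complexified (split) Grothendieck group `ℂ ⊗_ℤ K₀(A(t)-wmod_ω)` for the element `t` of a
submonoid `S` of `R`. Mathlib's graded rings have additive index monoids, hence `Additive S`. -/
abbrev Piece (k : K0Kind) (σ : R ≃+* R) (ω : Set (MaximalSpectrum R)) (S : Submonoid R)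
    (i : Additive S) : Type 1 :=
  ℂ ⊗[ℤ] K0 k σ ω (i.toMul : R)

namespace Piece

variable {k : K0Kind} {σ : R ≃+* R} {ω : Set (MaximalSpectrum R)} {S : Submonoid R}

/-- The multiplication `(c [M]) (d [N]) = c d [M ⊗_R N]`. -/
def mul {i j : Additive S} : Piece k σ ω S i →ₗ[ℤ] Piece k σ ω S j →ₗ[ℤ] Piece k σ ω S (i + j) :=
  TensorProduct.map₂ (LinearMap.mul ℤ ℂ) (K0.mul (t := (i.toMul : R)) (t' := (j.toMul : R)))

theorem mul_tmul_cls {i j : Additive S} (c d : ℂ) (M : WMod σ ω (i.toMul : R))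
    (N : WMod σ ω (j.toMul : R)) :
    mul (i := i) (j := j) (c ⊗ₜ[ℤ] K0.cls k M) (d ⊗ₜ[ℤ] K0.cls k N) =
      (c * d) ⊗ₜ[ℤ] K0.cls k (M.tensor N) := by
  change (c * d) ⊗ₜ[ℤ] (K0.mul (K0.cls k M) (K0.cls k N)) = _
  rw [K0.mul_cls]

theorem induction {i : Additive S} {P : Piece k σ ω S i → Prop}
    (h : ∀ (c : ℂ) (M : WMod σ ω (i.toMul : R)), P (c ⊗ₜ[ℤ] K0.cls k M))
    (hadd : ∀ x y, P x → P y → P (x + y)) (x : Piece k σ ω S i) : P x := by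
  induction x using TensorProduct.induction_on with
  | zero => simpa using h 0 (WMod.zero σ ω _)
  | add x y hx hy => exact hadd x y hx hy
  | tmul c x =>
    induction x using K0.induction generalizing c with
    | h M => exact h c M
    | hneg x hx =>
      rw [TensorProduct.tmul_neg, ← TensorProduct.neg_tmul]
      exact hx (-c)
    | hadd x y hx hy => rw [TensorProduct.tmul_add]; exact hadd _ _ (hx c) (hy c)

theorem mk_add {i j : Additive S} {a a' : Piece k σ ω S i} {b b' : Piece k σ ω S j}
    (h : GradedMonoid.mk (A := Piece k σ ω S) i a = GradedMonoid.mk j b)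
    (h' : GradedMonoid.mk (A := Piece k σ ω S) i a' = GradedMonoid.mk j b') :
    GradedMonoid.mk (A := Piece k σ ω S) i (a + a') = GradedMonoid.mk j (b + b') := by
  obtain rfl : i = j := congrArg Sigma.fst h
  obtain rfl := eq_of_heq (Sigma.mk.inj h).2
  obtain rfl := eq_of_heq (Sigma.mk.inj h').2
  rfl

theorem mk_cls {i j : Additive S} (hij : i = j) {c d : ℂ} (hcd : c = d)
    (M : WMod σ ω (i.toMul : R)) (N : WMod σ ω (j.toMul : R))
    (e : M ≃ₗ[R] N) (hX : ∀ v, e (M.actX v) = N.actX (e v))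
    (hY : ∀ v, e (M.actY v) = N.actY (e v)) :
    GradedMonoid.mk (A := Piece k σ ω S) i (c ⊗ₜ[ℤ] K0.cls k M) =
      GradedMonoid.mk j (d ⊗ₜ[ℤ] K0.cls k N) := by
  subst hij hcd
  rw [K0.cls_eq (GWA.linearEquivOf e hX hY)]

section
variable {i j l : Additive S}

theorem mk_assoc (x : Piece k σ ω S i) (y : Piece k σ ω S j) (z : Piece k σ ω S l) :
    GradedMonoid.mk (A := Piece k σ ω S) (i + j + l) (mul (mul x y) z) =
      GradedMonoid.mk (i + (j + l)) (mul x (mul y z)) := by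
  induction x using Piece.induction with
  | hadd x y hx hy => simp only [map_add, LinearMap.add_apply]; exact mk_add hx hy
  | h c M =>
  induction y using Piece.induction with
  | hadd x y hx hy => simp only [map_add, LinearMap.add_apply]; exact mk_add hx hy
  | h d N =>
  induction z using Piece.induction with
  | hadd x y hx hy => simp only [map_add]; exact mk_add hx hy
  | h c' P =>
  have h1 : mul (i := i + j) (j := l) (mul (c ⊗ₜ[ℤ] K0.cls k M) (d ⊗ₜ[ℤ] K0.cls k N))
      (c' ⊗ₜ[ℤ] K0.cls k P) = (c * d * c') ⊗ₜ[ℤ] K0.cls k ((M.tensor N).tensor P) := by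
    rw [mul_tmul_cls]
    exact mul_tmul_cls (i := i + j) (j := l) _ _ (M.tensor N) P
  have h2 : mul (i := i) (j := j + l) (c ⊗ₜ[ℤ] K0.cls k M) (mul (d ⊗ₜ[ℤ] K0.cls k N)
      (c' ⊗ₜ[ℤ] K0.cls k P)) = (c * (d * c')) ⊗ₜ[ℤ] K0.cls k (M.tensor (N.tensor P)) := by
    rw [mul_tmul_cls]
    exact mul_tmul_cls (i := i) (j := j + l) _ _ M (N.tensor P)
  rw [h1, h2]
  let e : ((M.tensor N).tensor P) ≃ₗ[R] (M.tensor (N.tensor P)) := TensorProduct.assoc R M N P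
  refine mk_cls (add_assoc i j l) (mul_assoc c d c') _ _ e
    (assoc_X M N P) (assoc_Y M N P)

theorem mk_comm (x : Piece k σ ω S i) (y : Piece k σ ω S j) :
    GradedMonoid.mk (A := Piece k σ ω S) (i + j) (mul x y) =
      GradedMonoid.mk (j + i) (mul y x) := by
  induction x using Piece.induction with
  | hadd x y hx hy => simp only [map_add, LinearMap.add_apply]; exact mk_add hx hy
  | h c M =>
  induction y using Piece.induction with
  | hadd x y hx hy => simp only [map_add, LinearMap.add_apply]; exact mk_add hx hy
  | h d N =>
  rw [mul_tmul_cls, mul_tmul_cls]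
  let e : (M.tensor N) ≃ₗ[R] (N.tensor M) := TensorProduct.comm R M N
  refine mk_cls (add_comm i j) (mul_comm c d) _ _ e
    (comm_X M N) (comm_Y M N)

/-- The canonical map from the split to the ordinary Grothendieck group, complexified. -/
def proj (σ : R ≃+* R) (ω : Set (MaximalSpectrum R)) (S : Submonoid R) (i : Additive S) :
    Piece .split σ ω S i →ₗ[ℂ] Piece .all σ ω S i :=
  LinearMap.baseChange ℂ (K0.proj σ ω (i.toMul : R))

theorem proj_tmul_cls (c : ℂ) (M : WMod σ ω (i.toMul : R)) :
    proj σ ω S i (c ⊗ₜ[ℤ] K0.cls .split M) = c ⊗ₜ[ℤ] K0.cls .all M := by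
  rw [proj, LinearMap.baseChange_tmul, K0.proj_cls]

theorem proj_mul (x : Piece .split σ ω S i) (y : Piece .split σ ω S j) :
    proj σ ω S (i + j) (mul x y) = mul (proj σ ω S i x) (proj σ ω S j y) := by
  induction x using Piece.induction with
  | hadd x x' hx hx' => simp only [map_add, LinearMap.add_apply, hx, hx']
  | h c M =>
  induction y using Piece.induction with
  | hadd y y' hy hy' => simp only [map_add, hy, hy']
  | h d N =>
  rw [mul_tmul_cls, proj_tmul_cls (i := i), proj_tmul_cls (i := j), mul_tmul_cls]
  exact proj_tmul_cls (i := i + j) _ (M.tensor N)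

variable [IsFiniteOrbit σ ω]

/-- The unit element. -/
def one : Piece k σ ω S 0 := (1 : ℂ) ⊗ₜ[ℤ] K0.cls k (WMod.unit σ ω)

theorem mk_smul_one_mul (c : ℂ) (x : Piece k σ ω S i) :
    GradedMonoid.mk (A := Piece k σ ω S) (0 + i) (mul (c • one) x) = GradedMonoid.mk i (c • x) := by
  induction x using Piece.induction with
  | hadd x y hx hy => simp only [map_add, smul_add]; exact mk_add hx hy
  | h d M =>
  rw [one, TensorProduct.smul_tmul', TensorProduct.smul_tmul']
  erw [mul_tmul_cls]
  refine mk_cls (zero_add i) (by simp) _ _ (WMod.unitTensor M)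
    (unit_X M) (unit_Y M)

theorem mk_one_mul (x : Piece k σ ω S i) :
    GradedMonoid.mk (A := Piece k σ ω S) (0 + i) (mul one x) = GradedMonoid.mk i x := by
  simpa using mk_smul_one_mul 1 x

instance : GradedMonoid.GMonoid (Piece k σ ω S) :=
  letI : GradedMonoid.GOne (Piece k σ ω S) := ⟨one⟩
  letI : GradedMonoid.GMul (Piece k σ ω S) := ⟨fun x y => mul x y⟩
  { one_mul := fun ⟨_, x⟩ => mk_one_mul x
    mul_one := fun ⟨_, x⟩ => (mk_comm x one).trans (mk_one_mul x)
    mul_assoc := fun ⟨_, x⟩ ⟨_, y⟩ ⟨_, z⟩ => mk_assoc x y z }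

instance : DirectSum.GCommRing (Piece k σ ω S) where
  __ := (inferInstance : GradedMonoid.GMonoid (Piece k σ ω S))
  mul_zero _ := map_zero (mul _)
  zero_mul b := LinearMap.congr_fun (map_zero mul) b
  mul_add _ := map_add (mul _)
  add_mul a b c := LinearMap.congr_fun (map_add mul a b) c
  mul_comm := fun ⟨_, x⟩ ⟨_, y⟩ => mk_comm x y
  natCast n := n • one
  natCast_zero := zero_smul _ _
  natCast_succ n := add_smul n 1 one |>.trans (by rw [one_smul]; rfl)
  intCast n := n • one
  intCast_ofNat n := natCast_zsmul one n
  intCast_negSucc_ofNat n := negSucc_zsmul one n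

instance : DirectSum.GAlgebra ℂ (Piece k σ ω S) where
  toFun := (LinearMap.toSpanSingleton ℂ (Piece k σ ω S 0) one).toAddMonoidHom
  map_one := one_smul ℂ one
  map_mul r s := by
    refine Eq.trans ?_ (mk_smul_one_mul r (s • one : Piece k σ ω S 0)).symm
    rw [smul_smul]
    rfl
  commutes r := fun ⟨_, x⟩ => mk_comm (r • one) x
  smul_def r := fun ⟨_, x⟩ => (mk_smul_one_mul r x).symm

end

end Piece

variable (k : K0Kind) (σ : R ≃+* R) (ω : Set (MaximalSpectrum R)) (S : Submonoid R)

/-- The Grothendieck ring `⨁_{t ∈ S} ℂ ⊗_ℤ K₀(A(t)-wmod_ω)` (`k = .all`) or the split Grothendieck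
ring `⨁_{t ∈ S} ℂ ⊗_ℤ K₀^split(A(t)-wmod_ω)` (`k = .split`). -/
def GrothRing : Type 1 := ⨁ i : Additive S, Piece k σ ω S i

namespace GrothRing

open scoped Classical in
instance [IsFiniteOrbit σ ω] : CommRing (GrothRing k σ ω S) :=
  inferInstanceAs (CommRing (⨁ i : Additive S, Piece k σ ω S i))

open scoped Classical in
instance [IsFiniteOrbit σ ω] : Algebra ℂ (GrothRing k σ ω S) :=
  inferInstanceAs (Algebra ℂ (⨁ i : Additive S, Piece k σ ω S i))

variable {σ ω S}

open scoped Classical in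
/-- The class `[M]` of an object `M` of `A(t)-wmod_ω`, in degree `t`. -/
def cls (t : S) (M : WMod σ ω (t : R)) : GrothRing k σ ω S :=
  DirectSum.of (Piece k σ ω S) (Additive.ofMul t) ((1 : ℂ) ⊗ₜ[ℤ] K0.cls k M)

variable [IsFiniteOrbit σ ω]

/-- The multiplication is given by `[M] [N] = [M ⊗_R N]`. -/
theorem cls_mul_cls (t t' : S) (M : WMod σ ω (t : R)) (N : WMod σ ω (t' : R)) :
    cls k t M * cls k t' N = cls k (t * t') (M.tensor N) := by
  classical
  refine (DirectSum.of_mul_of _ _).trans ?_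
  refine congrArg (DirectSum.of (Piece k σ ω S) (Additive.ofMul (t * t'))) ?_
  refine (Piece.mul_tmul_cls (i := Additive.ofMul t) (j := Additive.ofMul t') 1 1 M N).trans ?_
  rw [one_mul]

open scoped Classical in
/-- The canonical algebra map from the split Grothendieck ring to the Grothendieck ring, with
`[M] ↦ [M]`. -/
def proj (σ : R ≃+* R) (ω : Set (MaximalSpectrum R)) (S : Submonoid R) [IsFiniteOrbit σ ω] :
    GrothRing .split σ ω S →ₐ[ℂ] GrothRing .all σ ω S :=
  DirectSum.toAlgebra ℂ (Piece .split σ ω S)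
    (fun i => (DirectSum.lof ℂ (Additive S) (Piece .all σ ω S) i :
        Piece .all σ ω S i →ₗ[ℂ] GrothRing .all σ ω S) ∘ₗ Piece.proj σ ω S i)
    (congrArg (DirectSum.of (Piece .all σ ω S) 0)
      (Piece.proj_tmul_cls (i := (0 : Additive S)) 1 (WMod.unit σ ω)))
    (fun {i j} x y => (congrArg (DirectSum.of (Piece .all σ ω S) (i + j))
      (Piece.proj_mul x y)).trans (DirectSum.of_mul_of _ _).symm)

theorem proj_cls (t : S) (M : WMod σ ω (t : R)) : proj σ ω S (cls .split t M) = cls .all t M := by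
  classical
  exact (DirectSum.toModule_lof ℂ _ _).trans
    (congrArg (DirectSum.of (Piece .all σ ω S) (Additive.ofMul t))
      (Piece.proj_tmul_cls (i := Additive.ofMul t) 1 M))

end GrothRing
end ring

/-! ### The base ring `ℂ[z, z⁻¹]` with `σ(z) = q⁻¹ z` -/

section base

open LaurentPolynomial

theorem laurent_hom_ext {A : Type} [CommRing A] {f g : ℂ[T;T⁻¹] →+* A}
    (hC : ∀ a, f (C a) = g (C a)) (hT : f (T 1) = g (T 1)) : f = g := by
  refine IsLocalization.ringHom_ext (Submonoid.powers (Polynomial.X : Polynomial ℂ)) ?_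
  refine Polynomial.ringHom_ext (fun a => ?_) ?_
  · simpa using hC a
  · simpa using hT

/-- The unit `c z` of `ℂ[z, z⁻¹]`. -/
def unitCZ (c : ℂˣ) : ℂ[T;T⁻¹]ˣ where
  val := C (c : ℂ) * T 1
  inv := C ((c⁻¹ : ℂˣ) : ℂ) * T (-1)
  val_inv := by
    rw [mul_mul_mul_comm, ← map_mul, ← T_add]; simp
  inv_val := by
    rw [mul_mul_mul_comm, ← map_mul, ← T_add]; simp

/-- The endomorphism `f(z) ↦ f(c z)` of `ℂ[z, z⁻¹]`. -/
def scale (c : ℂˣ) : ℂ[T;T⁻¹] →+* ℂ[T;T⁻¹] := eval₂ C (unitCZ c)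

theorem scale_C (c : ℂˣ) (a : ℂ) : scale c (C a) = C a := eval₂_C ..

theorem scale_T (c : ℂˣ) : scale c (T 1) = C (c : ℂ) * T 1 := by
  rw [scale, eval₂_T, zpow_one, unitCZ]

theorem scale_comp (c d : ℂˣ) (h : c * d = 1) : (scale c).comp (scale d) = RingHom.id _ := by
  refine laurent_hom_ext (fun a => ?_) ?_
  · simp [scale_C]
  · rw [RingHom.comp_apply, scale_T, map_mul, scale_C, scale_T, ← mul_assoc, ← map_mul,
      ← Units.val_mul, mul_comm d, h]
    simp

/-- The primitive `p`-th root of unity `q = exp(2πi/p)`. -/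
def q (p : ℕ) : ℂˣ := Units.mk0 (Complex.exp (2 * Real.pi * Complex.I / p)) (Complex.exp_ne_zero _)

/-- The automorphism `σ` of `ℂ[z, z⁻¹]` with `σ(z) = q⁻¹ z` that is the identity on `ℂ`. -/
def sigma (p : ℕ) : ℂ[T;T⁻¹] ≃+* ℂ[T;T⁻¹] :=
  RingEquiv.ofRingHom (scale (q p)⁻¹) (scale (q p)) (scale_comp _ _ (inv_mul_cancel _))
    (scale_comp _ _ (mul_inv_cancel _))

/-- The orbit `ω = {(z - q ^ k) | 0 ≤ k < p}` of the maximal ideal `(z - 1)`. -/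
def orbit (p : ℕ) : Set (MaximalSpectrum ℂ[T;T⁻¹]) :=
  {m | ∃ k < p, m.asIdeal = Ideal.span {T 1 - C ((q p : ℂ) ^ k)}}

/-- The monoid `M₀` of powers of `z - 1`. -/
def M0 : Submonoid ℂ[T;T⁻¹] := Submonoid.powers (T 1 - 1)

theorem span_isMaximal (a : ℂˣ) : (Ideal.span {T 1 - C (a : ℂ)} : Ideal ℂ[T;T⁻¹]).IsMaximal := by
  let f : ℂ[T;T⁻¹] →+* ℂ := eval₂ (RingHom.id ℂ) a
  have hf : Function.Surjective f := fun x => ⟨C x, eval₂_C ..⟩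
  have : RingHom.ker f = Ideal.span {T 1 - C (a : ℂ)} := by
    apply le_antisymm
    · intro x hx
      have h : Ideal.Quotient.mk (Ideal.span {T 1 - C (a : ℂ)}) =
          ((Ideal.Quotient.mk (Ideal.span {T 1 - C (a : ℂ)})).comp C).comp f := by
        refine laurent_hom_ext (fun b => ?_) ?_
        · simp [f]
        · have h1 : f (T 1) = a := by simp [f, eval₂_T]
          rw [RingHom.comp_apply, RingHom.comp_apply, h1, Ideal.Quotient.eq]
          exact Ideal.mem_span_singleton_self _
      rw [← Ideal.Quotient.eq_zero_iff_mem, h, RingHom.comp_apply, RingHom.mem_ker.mp hx, map_zero]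
    · rw [Ideal.span_singleton_le_iff_mem, RingHom.mem_ker]
      simp [f, eval₂_T]
  rw [← this]
  exact RingHom.ker_isMaximal_of_surjective f hf

theorem map_sigma (p : ℕ) (a : ℂˣ) :
    (Ideal.span {T 1 - C (a : ℂ)}).map (sigma p) = Ideal.span {T 1 - C ((q p * a : ℂˣ) : ℂ)} := by
  rw [Ideal.map_span, Set.image_singleton]
  have h : (sigma p) (T 1 - C (a : ℂ)) =
      (T 1 - C ((q p * a : ℂˣ) : ℂ)) * C (((q p)⁻¹ : ℂˣ) : ℂ) := by
    change scale (q p)⁻¹ _ = _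
    rw [map_sub, scale_T, scale_C, sub_mul, ← map_mul, ← Units.val_mul, mul_comm (q p) a,
      mul_inv_cancel_right, mul_comm]
  rw [h]
  exact Ideal.span_singleton_mul_right_unit (((q p)⁻¹).isUnit.map C) _

theorem map_sigma_zpow (p : ℕ) (n : ℤ) (a : ℂˣ) :
    (Ideal.span {T 1 - C (a : ℂ)}).map (sigma p ^ n : ℂ[T;T⁻¹] ≃+* ℂ[T;T⁻¹]) =
      Ideal.span {T 1 - C ((q p ^ n * a : ℂˣ) : ℂ)} := by
  have hcomp : ∀ (f g : ℂ[T;T⁻¹] ≃+* ℂ[T;T⁻¹]) (I : Ideal ℂ[T;T⁻¹]),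
      I.map (f * g : ℂ[T;T⁻¹] ≃+* ℂ[T;T⁻¹]) = (I.map g).map f := fun f g I =>
    (Ideal.map_map (g : ℂ[T;T⁻¹] →+* ℂ[T;T⁻¹]) (f : ℂ[T;T⁻¹] →+* ℂ[T;T⁻¹])).symm
  have hinv : ∀ a : ℂˣ, (Ideal.span {T 1 - C (a : ℂ)}).map
      ((sigma p)⁻¹ : ℂ[T;T⁻¹] ≃+* ℂ[T;T⁻¹]) =
      Ideal.span {T 1 - C (((q p)⁻¹ * a : ℂˣ) : ℂ)} := fun a => by
    have h := map_sigma p ((q p)⁻¹ * a)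
    rw [mul_inv_cancel_left] at h
    rw [← h, ← hcomp, inv_mul_cancel]
    exact Ideal.map_id _
  induction n using Int.induction_on with
  | zero =>
    rw [zpow_zero, zpow_zero, one_mul]
    exact Ideal.map_id _
  | succ n ih => rw [add_comm, zpow_add, zpow_one, hcomp, ih, map_sigma, zpow_add, zpow_one,
      mul_assoc]
  | pred n ih => rw [sub_eq_neg_add, zpow_add, zpow_neg_one, hcomp, ih, hinv, zpow_add,
      zpow_neg_one, mul_assoc]

theorem q_pow (p : ℕ) [NeZero p] : q p ^ p = 1 := by
  have := (Complex.isPrimitiveRoot_exp p (NeZero.ne p)).pow_eq_one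
  exact Units.ext this

instance isFiniteOrbit (p : ℕ) [NeZero p] : IsFiniteOrbit (sigma p) (orbit p) where
  finite := by
    refine Set.Finite.of_finite_image (f := MaximalSpectrum.asIdeal) ?_
      (fun _ _ _ _ h => MaximalSpectrum.ext h)
    refine ((Set.finite_lt_nat p).image
      fun k => Ideal.span {T 1 - C ((q p : ℂ) ^ k)}).subset ?_
    rintro _ ⟨m, ⟨k, hk, h⟩, rfl⟩
    exact ⟨k, hk, h.symm⟩
  orbit := by
    refine ⟨⟨_, span_isMaximal 1⟩, ⟨0, NeZero.pos p, by simp⟩, ?_⟩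
    ext m
    simp only [Set.mem_ofPred_eq, map_sigma_zpow, mul_one, orbit]
    constructor
    · rintro ⟨k, -, h⟩
      exact ⟨k, by simpa using h⟩
    · rintro ⟨n, h⟩
      have hp : (0 : ℤ) < p := by exact_mod_cast NeZero.pos p
      refine ⟨(n % p).toNat, ?_, ?_⟩
      · have := Int.emod_lt_of_pos n hp
        have := Int.emod_nonneg n hp.ne'
        omega
      · have h1 : q p ^ n = q p ^ (n % p).toNat := by
          rw [← zpow_natCast, Int.toNat_of_nonneg (Int.emod_nonneg n hp.ne')]
          conv_lhs => rw [← Int.emod_add_mul_ediv n p, zpow_add, zpow_mul, zpow_natCast, q_pow,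
            one_zpow, mul_one]
        rw [h, h1, Units.val_pow_eq_pow_val]

end base

/-! ### The rings `𝒜^split(ω, M₀)` and `𝒜(ω, M₀)`, and the subspaces `𝒜_(j)` -/

/-- The split Grothendieck ring `𝒜^split(ω, M₀)`. -/
abbrev ASplit (p : ℕ) : Type 1 := GrothRing .split (sigma p) (orbit p) M0

/-- The Grothendieck ring `𝒜(ω, M₀)`. -/
abbrev AGroth (p : ℕ) : Type 1 := GrothRing .all (sigma p) (orbit p) M0

/-- A nonzero module that is not the direct sum of two nonzero submodules. -/
def IsIndecomposable (A V : Type) [Ring A] [AddCommGroup V] [Module A V] : Prop :=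
  Nontrivial V ∧ ∀ N P : Submodule A V, IsCompl N P → N = ⊥ ∨ P = ⊥

/-- The subspace `𝒜_(j)` of `𝒜^split(ω, M₀)` spanned by the classes of indecomposable weight modules
of length at most `j`. -/
def lengthSpan (p : ℕ) [NeZero p] (j : ℕ) : Submodule ℂ (ASplit p) :=
  Submodule.span ℂ {x | ∃ (t : M0) (M : WMod (sigma p) (orbit p) (t : LaurentPolynomial ℂ)),
    IsIndecomposable (GWA (sigma p) (t : LaurentPolynomial ℂ)) M ∧
    Module.length (GWA (sigma p) (t : LaurentPolynomial ℂ)) M ≤ j ∧ x = GrothRing.cls .split t M}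

end WeightRing

end

open WeightRing

noncomputable section

namespace WeightRing

/-! ### Weight modules over a commutative ring, and those with one-dimensional weight spaces -/

section weight
variable {R : Type} [CommRing R] {V W : Type} [AddCommGroup V] [Module R V]
  [AddCommGroup W] [Module R W] {ω : Set (MaximalSpectrum R)}

/-! Since `q` has order `p`, the operator `X` carries weight `q ^ k` to weight `q ^ (k + 1)` and `Y`
goes back, so the weights form a cycle of length `p`. An element `t = (z - 1) ^ n` can vanish on the
orbit only at the weight `1`, so `YX = t` is invertible at `q ^ k` for `0 < k < p`. Along the chain
`q, q ^ 2, …, q ^ p = 1` both `X` and `Y` are injective; only the edge joining `1` to `q` can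
degenerate. Hence a nonzero submodule meets every weight space (`exists_mem_weightSpace`), and a
thin module, one whose weight spaces over the orbit are lines, is simple (`IsThin.isSimpleModule`).

Conversely `σ ^ p = 1` makes `X ^ p` and `Y ^ p` central. By Schur's lemma they act on a simple
module by scalars `x`, `y`, so the vectors `v, X v, …, X ^ (p - 1) v` with `v ≠ 0` of weight `q`
span it, and it is thin (`isThin_of_isSimpleModule`). Thus simple means thin. The weight spaces of a
tensor product over `R` are the tensor products of the weight spaces, and a line tensored with a
line is a line (`IsThin.tensor`); the unit object is thin too. This gives the subalgebra.

The section is the inverse of the canonical map restricted to this subalgebra, so that restriction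
has to be bijective. It is surjective because modules have finite dimension and break up into simple
ones. For injectivity, a simple module is determined by `(t, x, y)`
(`nonempty_equiv_of_isSimpleModule`), and simple classes with distinct labels remain independent in
the ordinary Grothendieck ring: traces are additive on exact sequences, and the functional `t(3) ^ l
tr(X ^ (p i) Y ^ (p j))` takes the value `dim M · t(3) ^ l x ^ i y ^ j` on a simple `M`. Distinct
labels give distinct monoid homomorphisms from `ℕ³` to `ℂ`, which are independent by Dedekind's
theorem (`SimpleLabel.linearIndependent_proj_cls`). -/

theorem smul_eq_zero_of_mem_weightSpace {m : MaximalSpectrum R} {v : V}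
    (hv : v ∈ weightSpace R V m) {a : R} (ha : a ∈ m.asIdeal) : a • v = 0 :=
  (Submodule.mem_torsionBySet_iff _ _).mp hv ⟨a, ha⟩

/-- A quotient of a weight module is a weight module. -/
theorem IsFinWeightOn.of_surjective (hV : IsFinWeightOn R V ω) (f : V →ₗ[R] W)
    (hf : Function.Surjective f) : IsFinWeightOn R W ω := by
  have hle : ∀ m, (weightSpace R V m).map f ≤ weightSpace R W m := by
    rintro m _ ⟨v, hv, rfl⟩
    rw [Submodule.mem_torsionBySet_iff]
    rintro ⟨a, ha⟩
    change a • f v = 0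
    rw [← map_smul, smul_eq_zero_of_mem_weightSpace hv ha, map_zero]
  have hsup : ⨆ m, (weightSpace R V m).map f = ⊤ := by
    rw [← Submodule.map_iSup, isWeight_iff.mp hV.isWeight, Submodule.map_top,
      LinearMap.range_eq_top.mpr hf]
  have heq := weightSpace_eq _ hle hsup
  refine ⟨isWeight_iff.mpr ?_, fun m => ?_, fun m hm => hV.supp m fun h => hm ?_⟩
  · rw [eq_top_iff, ← hsup]; exact iSup_mono hle
  · rw [finite_quot_iff, heq m]
    have := (finite_quot_iff m).mp (hV.finite m)
    infer_instance
  · rw [heq m, h, Submodule.map_bot]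

/-- A submodule of a weight module is a weight module. -/
theorem IsFinWeightOn.of_injective (hV : IsFinWeightOn R V ω) (f : W →ₗ[R] V)
    (hf : Function.Injective f) : IsFinWeightOn R W ω := by
  obtain ⟨g, hg⟩ := hV.isWeight.exists_retraction f hf
  exact hV.of_surjective g fun w => ⟨f w, LinearMap.congr_fun hg w⟩

theorem IsFinWeightOn.exists_ne_zero (hV : IsFinWeightOn R V ω) [Nontrivial V] :
    ∃ m ∈ ω, ∃ v ∈ weightSpace R V m, v ≠ 0 := by
  by_contra! h
  have hbot : ∀ m, weightSpace R V m = ⊥ := fun m => by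
    by_contra hm
    exact hm ((Submodule.eq_bot_iff _).mpr (h m (hV.supp m hm)))
  have := isWeight_iff.mp hV.isWeight
  simp only [hbot, iSup_bot] at this
  exact bot_ne_top this

theorem IsFinWeightOn.iSup_mem_eq_top (hV : IsFinWeightOn R V ω) :
    ⨆ m ∈ ω, weightSpace R V m = ⊤ := by
  rw [eq_top_iff, ← isWeight_iff.mp hV.isWeight]
  refine iSup_le fun m => ?_
  by_cases h : weightSpace R V m = ⊥
  · rw [h]; exact bot_le
  · exact le_iSup₂_of_le m (hV.supp m h) le_rfl

/-- A scalar that does not kill `v` lies outside the maximal ideal, hence is invertible modulo it.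
-/
theorem span_singleton_eq_of_mem_weightSpace {m : MaximalSpectrum R} {u v : V}
    (hv : v ∈ weightSpace R V m) (hu : u ∈ Submodule.span R {v}) (hu0 : u ≠ 0) :
    v ∈ Submodule.span R {u} := by
  obtain ⟨r, rfl⟩ := Submodule.mem_span_singleton.mp hu
  have hr : r ∉ m.asIdeal := fun h => hu0 (smul_eq_zero_of_mem_weightSpace hv h)
  have hm := m.isMaximal
  obtain ⟨s, i, hi, h⟩ := hm.exists_inv hr
  refine Submodule.mem_span_singleton.mpr ⟨s, ?_⟩
  rw [← mul_smul, ← add_zero ((s * r) • v), ← smul_eq_zero_of_mem_weightSpace hv hi,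
    ← add_smul, h, one_smul]

/-- Functionals to the field `R ⧸ m` with value `1` at `v` and at `w` multiply to a functional on
the tensor product with value `1` at `v ⊗ w`. -/
theorem IsWeight.tmul_ne_zero (hV : IsWeight R V) (hW : IsWeight R W) {m : MaximalSpectrum R}
    {v : V} {w : W} (hv : v ∈ weightSpace R V m) (hw : w ∈ weightSpace R W m) (hv0 : v ≠ 0)
    (hw0 : w ≠ 0) : v ⊗ₜ[R] w ≠ 0 := by
  have key : ∀ {U : Type} [AddCommGroup U] [Module R U] (_ : IsWeight R U) {u : U}
      (_ : u ∈ weightSpace R U m) (_ : u ≠ 0),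
      ∃ g : U →ₗ[R] R ⧸ m.asIdeal, g u = 1 := by
    intro U _ _ hU u hu hu0
    -- The map `1 ↦ u` is injective because `m` is maximal, and it splits because a weight module is
    -- semisimple over `R`; the retraction is the functional.
    let f : (R ⧸ m.asIdeal) →ₗ[R] U := m.asIdeal.liftQ (LinearMap.toSpanSingleton R U u)
      fun a ha => smul_eq_zero_of_mem_weightSpace hu ha
    have hf : Function.Injective f := by
      rw [← LinearMap.ker_eq_bot, eq_bot_iff]
      intro x hx
      obtain ⟨a, rfl⟩ := Ideal.Quotient.mk_surjective x
      rw [Submodule.mem_bot, Ideal.Quotient.eq_zero_iff_mem]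
      by_contra ha
      have hm := m.isMaximal
      obtain ⟨s, i, hi, h⟩ := hm.exists_inv ha
      have hx' : a • u = 0 := hx
      apply hu0
      rw [← one_smul R u, ← h, add_smul, mul_smul, hx', smul_zero,
        smul_eq_zero_of_mem_weightSpace hu hi, add_zero]
    obtain ⟨g, hg⟩ := hU.exists_retraction f hf
    refine ⟨g, ?_⟩
    have h1 : f 1 = u := one_smul R u
    rw [← h1]
    exact LinearMap.congr_fun hg 1
  obtain ⟨f, hf⟩ := key hV hv hv0
  obtain ⟨g, hg⟩ := key hW hw hw0
  intro h
  have := congrArg (TensorProduct.lift ((LinearMap.mul R (R ⧸ m.asIdeal)).compl₁₂ f g)) h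
  simp [hf, hg] at this

/-- All weight spaces with weight in `ω` are one-dimensional. -/
def IsThin (R V : Type) [CommRing R] [AddCommGroup V] [Module R V]
    (ω : Set (MaximalSpectrum R)) : Prop :=
  ∀ m ∈ ω, ∃ v ∈ weightSpace R V m, v ≠ 0 ∧ weightSpace R V m ≤ Submodule.span R {v}

theorem IsThin.le_span (h : IsThin R V ω) {m : MaximalSpectrum R} (hm : m ∈ ω) {u : V}
    (hu : u ∈ weightSpace R V m) (hu0 : u ≠ 0) : weightSpace R V m ≤ Submodule.span R {u} := by
  obtain ⟨v, hv, -, hle⟩ := h m hm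
  refine hle.trans ?_
  rw [Submodule.span_singleton_le_iff_mem]
  exact span_singleton_eq_of_mem_weightSpace hv (hle hu) hu0

/-- By `weightSpace_eq` the weight space of the tensor product is the image of the tensor product of
two lines, so `v ⊗ w` generates it. -/
theorem IsThin.tensor (hV : IsWeight R V) (hW : IsWeight R W) (h : IsThin R V ω)
    (h' : IsThin R W ω) : IsThin R (V ⊗[R] W) ω := by
  intro m hm
  obtain ⟨v, hv, hv0, hvle⟩ := h m hm
  obtain ⟨w, hw, hw0, hwle⟩ := h' m hm
  have heq := weightSpace_eq _ tensorWeight_le (iSup_tensorWeight hV hW) m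
  refine ⟨v ⊗ₜ w, tensorWeight_le m ⟨⟨v, hv⟩ ⊗ₜ ⟨w, hw⟩, rfl⟩, hV.tmul_ne_zero hW hv hw hv0 hw0, ?_⟩
  rw [heq]
  rintro _ ⟨x, rfl⟩
  induction x with
  | zero => simp
  | add x y hx hy => rw [map_add]; exact add_mem hx hy
  | tmul x y =>
    obtain ⟨r, hr⟩ := Submodule.mem_span_singleton.mp (hvle x.2)
    obtain ⟨s, hs⟩ := Submodule.mem_span_singleton.mp (hwle y.2)
    refine Submodule.mem_span_singleton.mpr ⟨r * s, ?_⟩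
    rw [TensorProduct.map_tmul, Submodule.subtype_apply, Submodule.subtype_apply, ← hr, ← hs,
      TensorProduct.smul_tmul_smul]

/-- Finiteness of `ω` and primeness of `m` provide an element `a` outside `m` that lies in all the
other ideals of `ω`; its class is the idempotent of `m` up to a scalar invertible modulo `m`. -/
theorem IsThin.quot (hω : ω.Finite) : IsThin R (R ⧸ ⨅ m ∈ ω, m.asIdeal) ω := by
  intro m hm
  have hmax := m.isMaximal
  let J : Ideal R := ⨅ m' ∈ ω \ {m}, m'.asIdeal
  have hJm : J ⊓ m.asIdeal ≤ ⨅ m ∈ ω, m.asIdeal := by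
    refine le_iInf₂ fun m' hm' => ?_
    by_cases h : m' = m
    · rw [h]; exact inf_le_right
    · exact inf_le_of_left_le (iInf₂_le m' ⟨hm', h⟩)
  obtain ⟨a, haJ, ham⟩ : ∃ a ∈ J, a ∉ m.asIdeal := by
    by_contra! h
    have hfin : (ω \ {m}).Finite := hω.subset Set.sdiff_subset
    have h1 : hfin.toFinset.inf (fun m' : MaximalSpectrum R => m'.asIdeal) ≤ m.asIdeal := by
      refine le_trans ?_ h
      refine le_iInf₂ fun m' hm' => Finset.inf_le (hfin.mem_toFinset.mpr hm')
    obtain ⟨m', hm', hle⟩ := (Ideal.IsPrime.inf_le' hmax.isPrime).mp h1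
    have := hfin.mem_toFinset.mp hm'
    exact this.2 (MaximalSpectrum.ext (m'.isMaximal.eq_of_le hmax.ne_top hle))
  refine ⟨Ideal.Quotient.mk _ a, ?_, ?_, ?_⟩
  · rw [Submodule.mem_torsionBySet_iff]
    rintro ⟨b, hb⟩
    change Ideal.Quotient.mk _ (b * a) = 0
    rw [Ideal.Quotient.eq_zero_iff_mem]
    exact hJm ⟨Ideal.mul_mem_left _ _ haJ, Ideal.mul_mem_right _ _ hb⟩
  · rw [Ne, Ideal.Quotient.eq_zero_iff_mem]
    exact fun h => ham ((iInf₂_le m hm : _ ≤ m.asIdeal) h)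
  · intro x hx
    obtain ⟨b, rfl⟩ := Ideal.Quotient.mk_surjective x
    -- For `c` in `m` but not in `m'`, the product `c * b` vanishes in the quotient, so it lies in
    -- the prime `m'`, and therefore `b` does.
    have hbJ : b ∈ J := by
      simp only [J, Ideal.mem_iInf]
      intro m' hm'
      obtain ⟨c, hc, hc'⟩ : ∃ c ∈ m.asIdeal, c ∉ m'.asIdeal := by
        by_contra! h
        exact hm'.2 (MaximalSpectrum.ext (hmax.eq_of_le m'.isMaximal.ne_top h)).symm
      have h1 : Ideal.Quotient.mk (⨅ m ∈ ω, m.asIdeal) (c * b) = 0 :=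
        smul_eq_zero_of_mem_weightSpace hx hc
      rw [Ideal.Quotient.eq_zero_iff_mem] at h1
      exact (m'.isMaximal.isPrime.mem_or_mem
        ((iInf₂_le m' hm'.1 : _ ≤ m'.asIdeal) h1)).resolve_left hc'
    obtain ⟨s, i, hi, h⟩ := hmax.exists_inv ham
    refine Submodule.mem_span_singleton.mpr ⟨b * s, ?_⟩
    change Ideal.Quotient.mk _ (b * s * a) = _
    rw [Ideal.Quotient.eq]
    refine hJm ⟨sub_mem (Ideal.mul_mem_left _ _ haJ) hbJ, ?_⟩
    have : b * s * a - b = -b * i := by linear_combination b * h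
    rw [this]
    exact Ideal.mul_mem_left _ _ hi

end weight

/-! ### Central powers of the generators, and submodules generated by weight vectors -/

namespace GWA

section
variable {R : Type} [CommRing R] {σ : R ≃+* R} {t : R}

/-- An element of `A(t)` that commutes with `R`, `X` and `Y` is central. -/
theorem commute_of_generators {a : GWA σ t} (hR : ∀ r, Commute a (incl σ t r))
    (hX : Commute a (X σ t)) (hY : Commute a (Y σ t)) (b : GWA σ t) : Commute a b := by
  obtain ⟨b, rfl⟩ := mk_surjective σ t b
  induction b using FreeAlgebra.induction with
  | grade0 n => simp
  | grade1 x =>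
    cases x with
    | coe r => exact hR r
    | X => exact hX
    | Y => exact hY
  | mul b c hb hc => rw [map_mul]; exact hb.mul_right hc
  | add b c hb hc => rw [map_add]; exact hb.add_right hc

theorem X_pow_incl (n : ℕ) (r : R) :
    X σ t ^ n * incl σ t r = incl σ t ((σ ^ n : R ≃+* R) r) * X σ t ^ n := by
  induction n with
  | zero => simp
  | succ n ih =>
    rw [pow_succ', mul_assoc, ih, ← mul_assoc, X_incl, mul_assoc, pow_succ' σ]
    rfl

theorem Y_pow_incl (n : ℕ) (r : R) :
    Y σ t ^ n * incl σ t ((σ ^ n : R ≃+* R) r) = incl σ t r * Y σ t ^ n := by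
  induction n with
  | zero => simp
  | succ n ih =>
    rw [pow_succ, mul_assoc, pow_succ' σ, RingAut.mul_apply, Y_incl, σ.symm_apply_apply,
      ← mul_assoc, ih, mul_assoc]

/-- If `σ ^ n = 1` then `X ^ n` is central. -/
theorem commute_X_pow {n : ℕ} (hn : σ ^ n = 1) (b : GWA σ t) : Commute (X σ t ^ n) b := by
  obtain _ | n := n
  · simp
  have hn' : ∀ r, (σ ^ n : R ≃+* R) (σ r) = r := fun r => by
    rw [← RingAut.mul_apply, ← pow_succ, hn]; rfl
  refine commute_of_generators (fun r => ?_) ((Commute.refl _).pow_left _) ?_ b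
  · rw [Commute, SemiconjBy, X_pow_incl, hn]; rfl
  -- `X ^ (n + 1) Y = X ^ n σ(t) = σ ^ (n + 1)(t) X ^ n = t X ^ n = Y X ^ (n + 1)`.
  · rw [Commute, SemiconjBy, pow_succ, mul_assoc, X_Y, X_pow_incl, hn', ← pow_succ, pow_succ',
      ← mul_assoc, Y_X]

/-- If `σ ^ n = 1` then `Y ^ n` is central. -/
theorem commute_Y_pow {n : ℕ} (hn : σ ^ n = 1) (b : GWA σ t) : Commute (Y σ t ^ n) b := by
  obtain _ | n := n
  · simp
  refine commute_of_generators (fun r => ?_) ?_ ((Commute.refl _).pow_left _) b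
  · have h := Y_pow_incl (σ := σ) (t := t) (n + 1) r
    rw [hn] at h
    exact h
  -- `Y ^ (n + 1) X = Y ^ n t = σ(t) Y ^ n = X Y ^ (n + 1)`, where the middle equality uses `σ ^ (n
  -- + 1) = 1`.
  · have h := Y_pow_incl (σ := σ) (t := t) n (σ t)
    rw [← RingAut.mul_apply, ← pow_succ, hn] at h
    rw [Commute, SemiconjBy, pow_succ, mul_assoc, Y_X, ← pow_succ, pow_succ',
      ← mul_assoc, X_Y]
    exact h

variable {V : Type} [AddCommGroup V] [Module R V] [Module (GWA σ t) V]
  [IsScalarTower R (GWA σ t) V]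

theorem X_smul_smul (r : R) (v : V) : X σ t • r • v = σ r • X σ t • v :=
  (actX σ t).map_smulₛₗ r v

theorem Y_smul_smul (r : R) (v : V) : Y σ t • r • v = σ.symm r • Y σ t • v :=
  (actY σ t).map_smulₛₗ r v

theorem Y_smul_X_smul (v : V) : Y σ t • X σ t • v = t • v := actY_actX σ t v

theorem X_smul_Y_smul (v : V) : X σ t • Y σ t • v = σ t • v := actX_actY σ t v

/-- An `R`-submodule that is stable under `X` and `Y` is an `A(t)`-submodule. -/
def submoduleOf (N : Submodule R V) (hX : ∀ v ∈ N, X σ t • v ∈ N) (hY : ∀ v ∈ N, Y σ t • v ∈ N) :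
    Submodule (GWA σ t) V where
  __ := N.toAddSubmonoid
  smul_mem' a v hv := by
    obtain ⟨a, rfl⟩ := mk_surjective σ t a
    change _ ∈ N
    replace hv : v ∈ N := hv
    induction a using FreeAlgebra.induction generalizing v with
    | grade0 n => simpa [Int.cast_smul_eq_zsmul] using zsmul_mem hv n
    | grade1 x =>
      cases x with
      | coe r =>
        change incl σ t r • v ∈ N
        rw [incl_smul]
        exact N.smul_mem r hv
      | X => exact hX v hv
      | Y => exact hY v hv
    | mul a b ha hb => rw [map_mul, mul_smul]; exact ha _ (hb _ hv)
    | add a b ha hb => rw [map_add, add_smul]; exact add_mem (ha _ hv) (hb _ hv)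

/-- A set of vectors, not all zero, whose images under `X` and `Y` lie in its `R`-span generates a
simple module over `R`. -/
theorem span_eq_top_of_isSimpleModule [IsSimpleModule (GWA σ t) V] (S : Set V)
    (hX : ∀ v ∈ S, X σ t • v ∈ Submodule.span R S) (hY : ∀ v ∈ S, Y σ t • v ∈ Submodule.span R S)
    (hS : ∃ v ∈ S, v ≠ 0) : Submodule.span R S = ⊤ := by
  obtain ⟨v, hv, hv0⟩ := hS
  let N : Submodule (GWA σ t) V := submoduleOf (Submodule.span R S)
    (fun v hv => by
      induction hv using Submodule.span_induction with
      | mem v hv => exact hX v hv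
      | zero => simp
      | add v w _ _ hv hw => rw [smul_add]; exact add_mem hv hw
      | smul r v _ hv => rw [X_smul_smul]; exact Submodule.smul_mem _ _ hv)
    (fun v hv => by
      induction hv using Submodule.span_induction with
      | mem v hv => exact hY v hv
      | zero => simp
      | add v w _ _ hv hw => rw [smul_add]; exact add_mem hv hw
      | smul r v _ hv => rw [Y_smul_smul]; exact Submodule.smul_mem _ _ hv)
  have hvN : v ∈ N := Submodule.subset_span (s := S) hv
  have hN : N = ⊤ := (eq_bot_or_eq_top N).resolve_left fun h => by
    rw [h] at hvN
    exact hv0 ((Submodule.mem_bot _).mp hvN)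
  rw [eq_top_iff]
  intro x _
  have : x ∈ N := by rw [hN]; trivial
  exact this

end

end GWA

/-! ### Traces and short exact sequences -/

/-- The trace is additive on short exact sequences. -/
theorem trace_eq_add_of_exact {K V' V V'' : Type*} [Field K] [AddCommGroup V'] [Module K V']
    [AddCommGroup V] [Module K V] [AddCommGroup V''] [Module K V''] [FiniteDimensional K V']
    [FiniteDimensional K V] [FiniteDimensional K V''] {f : V' →ₗ[K] V} {g : V →ₗ[K] V''}
    (hf : Function.Injective f) (hfg : Function.Exact f g) (hg : Function.Surjective g)
    {a' : Module.End K V'} {a : Module.End K V} {a'' : Module.End K V''}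
    (hf' : a ∘ₗ f = f ∘ₗ a') (hg' : g ∘ₗ a = a'' ∘ₗ g) :
    LinearMap.trace K V a = LinearMap.trace K V' a' + LinearMap.trace K V'' a'' := by
  obtain ⟨s, hs⟩ := g.exists_rightInverse_of_surjective (LinearMap.range_eq_top.mpr hg)
  have hmem : ∀ x, (LinearMap.id - s ∘ₗ g : V →ₗ[K] V) x ∈ LinearMap.range f := fun x => by
    refine (hfg _).mp ?_
    have := LinearMap.congr_fun hs (g x)
    simp only [LinearMap.comp_apply, LinearMap.id_apply] at this
    simp [this]
  -- The retraction complementary to the section `s`: together they give `id = f r + s g`.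
  let r : V →ₗ[K] V' := (LinearEquiv.ofInjective f hf).symm.toLinearMap ∘ₗ
    LinearMap.codRestrict _ (LinearMap.id - s ∘ₗ g) hmem
  have hfr : ∀ x, f (r x) = x - s (g x) := fun x =>
    congrArg Subtype.val ((LinearEquiv.ofInjective f hf).apply_symm_apply ⟨_, hmem x⟩)
  have hrf : r ∘ₗ f = LinearMap.id := LinearMap.ext fun x => hf <| by
    have : g (f x) = 0 := (hfg _).mpr ⟨x, rfl⟩
    simp [hfr, this]
  -- The trace of a composite is unchanged by swapping its factors, so the two summands have the
  -- traces of `a' r f = a'` and `g a s = a''`.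
  have hdec : a = f ∘ₗ (a' ∘ₗ r) + (a ∘ₗ s) ∘ₗ g := LinearMap.ext fun x => by
    have h1 := LinearMap.congr_fun hf' (r x)
    simp only [LinearMap.comp_apply] at h1
    simp [← h1, hfr]
  have h2 : g ∘ₗ (a ∘ₗ s) = a'' := by
    rw [← LinearMap.comp_assoc, hg', LinearMap.comp_assoc, hs, LinearMap.comp_id]
  conv_lhs => rw [hdec]
  rw [map_add, LinearMap.trace_comp_comm', LinearMap.comp_assoc, hrf, LinearMap.comp_id,
    LinearMap.trace_comp_comm', h2]

/-! ### Evaluation on the orbit of `(z - 1)` and the order of `σ` -/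

section base

open LaurentPolynomial

/-- Evaluation of Laurent polynomials at `a`. -/
def ev (a : ℂˣ) : ℂ[T;T⁻¹] →+* ℂ := eval₂ (RingHom.id ℂ) a

theorem ev_C (a : ℂˣ) (c : ℂ) : ev a (C c) = c := eval₂_C ..

theorem ev_T (a : ℂˣ) : ev a (T 1) = a := by simp [ev, eval₂_T]

/-- The residue field at `(z - a)` is `ℂ`: the quotient map and evaluation followed by the constants
agree on `ℂ` and on `z`. -/
theorem sub_ev_mem (a : ℂˣ) (r : ℂ[T;T⁻¹]) :
    r - C (ev a r) ∈ (Ideal.span {T 1 - C (a : ℂ)} : Ideal ℂ[T;T⁻¹]) := by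
  have h : Ideal.Quotient.mk (Ideal.span {T 1 - C (a : ℂ)}) =
      ((Ideal.Quotient.mk (Ideal.span {T 1 - C (a : ℂ)})).comp C).comp (ev a) := by
    refine laurent_hom_ext (fun b => ?_) ?_
    · simp [ev_C]
    · rw [RingHom.comp_apply, RingHom.comp_apply, ev_T, Ideal.Quotient.eq]
      exact Ideal.mem_span_singleton_self _
  exact Ideal.Quotient.eq.mp (RingHom.congr_fun h r)

theorem sigma_C (p : ℕ) (c : ℂ) : sigma p (C c) = C c := scale_C ..

theorem sigma_symm_C (p : ℕ) (c : ℂ) : (sigma p).symm (C c) = C c := scale_C ..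

/-- This makes `YX = t` at weight `q ^ k` and `XY = σ(t)` at weight `q ^ (k + 1)` the same scalar.
-/
theorem ev_sigma (p : ℕ) (a : ℂˣ) (r : ℂ[T;T⁻¹]) : ev (q p * a) (sigma p r) = ev a r := by
  refine RingHom.congr_fun (?_ : (ev (q p * a)).comp (sigma p : ℂ[T;T⁻¹] →+* ℂ[T;T⁻¹]) = ev a) r
  refine laurent_hom_ext (fun b => ?_) ?_
  · simp [sigma_C, ev_C]
  · have : sigma p (T 1) = C (((q p)⁻¹ : ℂˣ) : ℂ) * T 1 := scale_T _
    rw [RingHom.comp_apply, RingHom.coe_coe, this, map_mul, ev_C, ev_T, ev_T, ← Units.val_mul,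
      inv_mul_cancel_left]

theorem sigma_pow_apply_T (p n : ℕ) :
    (sigma p ^ n : ℂ[T;T⁻¹] ≃+* ℂ[T;T⁻¹]) (T 1) = C ((((q p)⁻¹ : ℂˣ) : ℂ) ^ n) * T 1 := by
  induction n with
  | zero => simp
  | succ n ih =>
    have : sigma p (T 1) = C (((q p)⁻¹ : ℂˣ) : ℂ) * T 1 := scale_T _
    rw [pow_succ', RingAut.mul_apply, ih, map_mul, sigma_C, this, ← mul_assoc, ← map_mul,
      ← pow_succ]

theorem sigma_pow_self (p : ℕ) [NeZero p] : sigma p ^ p = 1 := by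
  have h : ((sigma p ^ p : ℂ[T;T⁻¹] ≃+* ℂ[T;T⁻¹]) : ℂ[T;T⁻¹] →+* ℂ[T;T⁻¹]) = RingHom.id _ := by
    refine laurent_hom_ext (fun a => ?_) ?_
    · have : ∀ n : ℕ, (sigma p ^ n : ℂ[T;T⁻¹] ≃+* ℂ[T;T⁻¹]) (C a) = C a := fun n => by
        induction n with
        | zero => rfl
        | succ n ih => rw [pow_succ', RingAut.mul_apply, ih, sigma_C]
      exact this p
    · rw [RingHom.coe_coe, sigma_pow_apply_T, ← Units.val_pow_eq_pow_val, inv_pow, q_pow]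
      simp
  exact RingEquiv.ext fun r => RingHom.congr_fun h r

theorem q_isPrimitiveRoot (p : ℕ) [NeZero p] : IsPrimitiveRoot (q p : ℂ) p :=
  Complex.isPrimitiveRoot_exp p (NeZero.ne p)

/-- The maximal ideal `(z - q ^ k)`. -/
def wt (p k : ℕ) : MaximalSpectrum ℂ[T;T⁻¹] := ⟨_, span_isMaximal (q p ^ k)⟩

theorem wt_mem_orbit (p : ℕ) [NeZero p] (k : ℕ) : wt p k ∈ orbit p := by
  refine ⟨k % p, Nat.mod_lt _ (NeZero.pos p), ?_⟩
  change Ideal.span _ = _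
  rw [← Units.val_pow_eq_pow_val, ← pow_mod_orderOf, ← pow_mod_orderOf (q p) (k % p),
    Nat.mod_mod_of_dvd _ (orderOf_dvd_of_pow_eq_one (q_pow p))]

/-- The exponents are chosen in `1, …, p`, with `1` written as `q ^ p`, so that the edge where `t`
may vanish joins the two ends of the chain and is never crossed inside it. -/
theorem exists_eq_wt {p : ℕ} [NeZero p] {m : MaximalSpectrum ℂ[T;T⁻¹]} (hm : m ∈ orbit p) :
    ∃ k < p, m = wt p (k + 1) := by
  obtain ⟨k, hk, h⟩ := hm
  obtain _ | k := k
  · have hp := Nat.sub_add_cancel (NeZero.one_le (n := p))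
    refine ⟨p - 1, by omega, MaximalSpectrum.ext (h.trans ?_)⟩
    change _ = Ideal.span _
    rw [hp, q_pow]
    simp
  · refine ⟨k, by omega, MaximalSpectrum.ext (h.trans ?_)⟩
    change _ = Ideal.span _
    rw [Units.val_pow_eq_pow_val]

theorem wt_succ_injOn {p : ℕ} [NeZero p] {k l : ℕ} (hk : k < p) (hl : l < p)
    (h : wt p (k + 1) = wt p (l + 1)) : k = l := by
  have h1 : (T 1 - C ((q p ^ (k + 1) : ℂˣ) : ℂ) : ℂ[T;T⁻¹]) ∈ (wt p (l + 1)).asIdeal := by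
    rw [← h]; exact Ideal.mem_span_singleton_self _
  obtain ⟨r, hr⟩ := Ideal.mem_span_singleton.mp h1
  have h2 := congrArg (ev (q p ^ (l + 1))) hr
  rw [map_mul, map_sub, map_sub, ev_T, ev_C, ev_C, sub_self, zero_mul, sub_eq_zero] at h2
  have h3 : q p ^ l = q p ^ k := by
    have := Units.ext h2
    rw [pow_succ, pow_succ] at this
    exact mul_right_cancel this
  have h4 : (q p : ℂ) ^ l = (q p : ℂ) ^ k := by
    rw [← Units.val_pow_eq_pow_val, h3, Units.val_pow_eq_pow_val]
  exact ((q_isPrimitiveRoot p).pow_inj hl hk h4).symm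

/-- The value is `(q ^ k - 1) ^ n`, and `q` is a primitive `p`-th root of unity. -/
theorem ev_M0_ne_zero {p : ℕ} [NeZero p] (t : M0) {k : ℕ} (hk : k ≠ 0) (hkp : k < p) :
    ev (q p ^ k) t ≠ 0 := by
  obtain ⟨n, hn⟩ := t.2
  have hn' : (T 1 - 1 : ℂ[T;T⁻¹]) ^ n = t := hn
  rw [← hn', map_pow, map_sub, map_one, ev_T, Units.val_pow_eq_pow_val]
  exact pow_ne_zero _ (sub_ne_zero.mpr ((q_isPrimitiveRoot p).pow_ne_one_of_pos_of_lt hk hkp))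

end base

/-! ### Weight vectors, finite dimension, and simplicity of thin modules -/

section module

open LaurentPolynomial

variable {p : ℕ} {t : ℂ[T;T⁻¹]}

/-- The complex vector space underlying a weight module. -/
instance (M : WMod (sigma p) (orbit p) t) : Module ℂ M :=
  Module.compHom M (C : ℂ →+* ℂ[T;T⁻¹])

theorem C_smul (M : WMod (sigma p) (orbit p) t) (c : ℂ) (v : M) : C c • v = c • v := rfl

instance (M : WMod (sigma p) (orbit p) t) : IsScalarTower ℂ ℂ[T;T⁻¹] M where
  smul_assoc c r v := by rw [smul_eq_C_mul, mul_smul, C_smul]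

/-- Constants are fixed by `σ`, so multiplication by one commutes with `X` and `Y` and is
`A(t)`-linear. -/
instance (M : WMod (sigma p) (orbit p) t) : SMulCommClass (GWA (sigma p) t) ℂ M where
  smul_comm a c v := by
    let f : M →ₗ[GWA (sigma p) t] M := GWA.linearMapOf (LinearMap.lsmul ℂ[T;T⁻¹] M (C c))
      (fun v => by
        change C c • GWA.X (sigma p) t • v = GWA.X (sigma p) t • C c • v
        rw [GWA.X_smul_smul, sigma_C])
      (fun v => by
        change C c • GWA.Y (sigma p) t • v = GWA.Y (sigma p) t • C c • v
        rw [GWA.Y_smul_smul, sigma_symm_C])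
    exact (map_smul f a v).symm

/-- `A(t)`-linear maps are `ℂ`-linear. -/
def restrictC {M N : WMod (sigma p) (orbit p) t} (f : M →ₗ[GWA (sigma p) t] N) : M →ₗ[ℂ] N where
  toFun := f
  map_add' := map_add f
  map_smul' c v := (GWA.restrict (sigma p) t f).map_smul (C c) v

/-- The action of an element of `A(t)` as a `ℂ`-linear map. -/
def act (M : WMod (sigma p) (orbit p) t) : GWA (sigma p) t →+* Module.End ℂ M :=
  Module.toModuleEnd ℂ M

theorem smul_of_mem (M : WMod (sigma p) (orbit p) t) {k : ℕ} {v : M}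
    (hv : v ∈ weightSpace ℂ[T;T⁻¹] M (wt p k)) (r : ℂ[T;T⁻¹]) : r • v = ev (q p ^ k) r • v := by
  rw [← C_smul, ← sub_eq_zero, ← sub_smul]
  exact smul_eq_zero_of_mem_weightSpace hv (sub_ev_mem _ r)

theorem mem_weightSpace_of_smul_eq (M : WMod (sigma p) (orbit p) t) {k : ℕ} {v : M}
    (hv : (T 1 : ℂ[T;T⁻¹]) • v = (q p ^ k : ℂˣ).1 • v) :
    v ∈ weightSpace ℂ[T;T⁻¹] M (wt p k) := by
  rw [Submodule.mem_torsionBySet_iff]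
  rintro ⟨r, hr⟩
  obtain ⟨s, rfl⟩ := Ideal.mem_span_singleton.mp hr
  change ((T 1 - C ((q p ^ k : ℂˣ) : ℂ)) * s) • v = 0
  rw [mul_comm, mul_smul, sub_smul, hv, C_smul, sub_self, smul_zero]

/-- `z X v = X σ⁻¹(z) v`, and `σ⁻¹(z) = q z`, so the eigenvalue of `z` is multiplied by `q`. -/
theorem X_smul_mem (M : WMod (sigma p) (orbit p) t) {k : ℕ} {v : M}
    (hv : v ∈ weightSpace ℂ[T;T⁻¹] M (wt p k)) :
    GWA.X (sigma p) t • v ∈ weightSpace ℂ[T;T⁻¹] M (wt p (k + 1)) := by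
  apply mem_weightSpace_of_smul_eq
  have h := GWA.X_smul_smul (σ := sigma p) (t := t) ((sigma p).symm (T 1)) v
  rw [(sigma p).apply_symm_apply] at h
  rw [← h, smul_of_mem M hv, smul_comm, ← ev_sigma, ← pow_succ', (sigma p).apply_symm_apply, ev_T]

theorem Y_smul_mem (M : WMod (sigma p) (orbit p) t) {k : ℕ} {v : M}
    (hv : v ∈ weightSpace ℂ[T;T⁻¹] M (wt p (k + 1))) :
    GWA.Y (sigma p) t • v ∈ weightSpace ℂ[T;T⁻¹] M (wt p k) := by
  apply mem_weightSpace_of_smul_eq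
  have h := GWA.Y_smul_smul (σ := sigma p) (t := t) (sigma p (T 1)) v
  rw [(sigma p).symm_apply_apply] at h
  rw [← h, smul_of_mem M hv, smul_comm, pow_succ', ev_sigma, ev_T]

theorem Y_smul_X_smul_of_mem (M : WMod (sigma p) (orbit p) t) {k : ℕ} {v : M}
    (hv : v ∈ weightSpace ℂ[T;T⁻¹] M (wt p k)) :
    GWA.Y (sigma p) t • GWA.X (sigma p) t • v = ev (q p ^ k) t • v := by
  rw [GWA.Y_smul_X_smul, smul_of_mem M hv]

theorem X_smul_Y_smul_of_mem (M : WMod (sigma p) (orbit p) t) {k : ℕ} {v : M}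
    (hv : v ∈ weightSpace ℂ[T;T⁻¹] M (wt p (k + 1))) :
    GWA.X (sigma p) t • GWA.Y (sigma p) t • v = ev (q p ^ k) t • v := by
  rw [GWA.X_smul_Y_smul, smul_of_mem M hv, pow_succ', ev_sigma]

variable [NeZero p]

/-- There are finitely many weights, and on a weight space `R` acts through `ℂ`, so finitely many
generators over `R` also generate it over `ℂ`. -/
instance (M : WMod (sigma p) (orbit p) t) : FiniteDimensional ℂ M := by
  have key : ∀ k, ∃ N : Submodule ℂ M, N.FG ∧
      ∀ v ∈ weightSpace ℂ[T;T⁻¹] M (wt p k), v ∈ N := fun k => by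
    have := (finite_quot_iff _).mp (M.isFinWeightOn.finite (wt p k))
    obtain ⟨S, hS⟩ := (Module.Finite.iff_fg (N := weightSpace ℂ[T;T⁻¹] M (wt p k))).mp this
    refine ⟨Submodule.span ℂ (S : Set M), ⟨S, rfl⟩, fun v hv => ?_⟩
    rw [← hS] at hv
    induction hv using Submodule.span_induction with
    | mem v hv => exact Submodule.subset_span hv
    | zero => exact zero_mem _
    | add v w _ _ hv hw => exact add_mem hv hw
    | smul r v hv' hv =>
      rw [hS] at hv'
      rw [smul_of_mem M hv']
      exact Submodule.smul_mem _ _ hv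
  choose N hN hle using key
  have hfg : (⨆ k ∈ Finset.range p, N (k + 1)).FG := Submodule.fg_biSup _ _ fun k _ => hN (k + 1)
  have htop : ⨆ k ∈ Finset.range p, N (k + 1) = ⊤ := by
    rw [eq_top_iff]
    intro v _
    have hv : v ∈ ⨆ m ∈ orbit p, weightSpace ℂ[T;T⁻¹] M m := by
      rw [M.isFinWeightOn.iSup_mem_eq_top]; trivial
    rw [iSup_subtype'] at hv
    induction hv using Submodule.iSup_induction' with
    | zero => exact zero_mem _
    | add v w _ _ hv hw => exact add_mem (hv trivial) (hw trivial)
    | mem m v hv =>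
      obtain ⟨m, hm⟩ := m
      obtain ⟨k, hk, rfl⟩ := exists_eq_wt hm
      have hle' : N (k + 1) ≤ ⨆ k ∈ Finset.range p, N (k + 1) :=
        le_iSup₂_of_le (f := fun k (_ : k ∈ Finset.range p) => N (k + 1)) k
          (Finset.mem_range.mpr hk) le_rfl
      exact hle' (hle _ v hv)
  exact ⟨htop ▸ hfg⟩

/-- Applying `Y` returns a nonzero multiple of `v`, by `ev_M0_ne_zero`. -/
theorem X_smul_ne_zero {t : M0} (M : WMod (sigma p) (orbit p) (t : ℂ[T;T⁻¹])) {k : ℕ} (hk : k ≠ 0)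
    (hkp : k < p) {v : M} (hv : v ∈ weightSpace ℂ[T;T⁻¹] M (wt p k)) (hv0 : v ≠ 0) :
    GWA.X (sigma p) (t : ℂ[T;T⁻¹]) • v ≠ 0 := fun h => by
  have := Y_smul_X_smul_of_mem M hv
  rw [h, smul_zero] at this
  exact (smul_ne_zero (ev_M0_ne_zero t hk hkp) hv0) this.symm

theorem Y_smul_ne_zero {t : M0} (M : WMod (sigma p) (orbit p) (t : ℂ[T;T⁻¹])) {k : ℕ} (hk : k ≠ 0)
    (hkp : k < p) {v : M} (hv : v ∈ weightSpace ℂ[T;T⁻¹] M (wt p (k + 1))) (hv0 : v ≠ 0) :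
    GWA.Y (sigma p) (t : ℂ[T;T⁻¹]) • v ≠ 0 := fun h => by
  have := X_smul_Y_smul_of_mem M hv
  rw [h, smul_zero] at this
  exact (smul_ne_zero (ev_M0_ne_zero t hk hkp) hv0) this.symm

/-- A nonzero submodule of a weight module contains nonzero vectors of every weight. -/
theorem exists_mem_weightSpace {t : M0} (M : WMod (sigma p) (orbit p) (t : ℂ[T;T⁻¹]))
    {N : Submodule (GWA (sigma p) (t : ℂ[T;T⁻¹])) M} (hN : N ≠ ⊥) {k : ℕ} (hk : k < p) :
    ∃ v ∈ N, v ∈ weightSpace ℂ[T;T⁻¹] M (wt p (k + 1)) ∧ v ≠ 0 := by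
  let N' : Submodule ℂ[T;T⁻¹] M := N.restrictScalars ℂ[T;T⁻¹]
  have hnt : Nontrivial N' := by
    obtain ⟨v, hv, hv0⟩ := Submodule.exists_mem_ne_zero_of_ne_bot hN
    exact ⟨⟨⟨v, hv⟩, 0, fun h => hv0 (congrArg Subtype.val h)⟩⟩
  have hw := M.isFinWeightOn.of_injective N'.subtype N'.injective_subtype
  obtain ⟨m, hm, v, hv, hv0⟩ := hw.exists_ne_zero
  obtain ⟨l, hl, rfl⟩ := exists_eq_wt hm
  have hv' : (v : M) ∈ weightSpace ℂ[T;T⁻¹] M (wt p (l + 1)) := by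
    rw [Submodule.mem_torsionBySet_iff] at hv ⊢
    exact fun a => congrArg Subtype.val (hv a)
  have hv0' : (v : M) ≠ 0 := fun h => hv0 (Subtype.ext h)
  -- From an arbitrary weight in the chain, `Y` leads down to weight `q`; from there `X` climbs to
  -- the wanted weight. Neither path uses the edge between `1` and `q`.
  have down : ∀ l < p, ∀ v ∈ N, v ∈ weightSpace ℂ[T;T⁻¹] M (wt p (l + 1)) → v ≠ 0 →
      ∃ v ∈ N, v ∈ weightSpace ℂ[T;T⁻¹] M (wt p 1) ∧ v ≠ 0 := by
    intro l
    induction l with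
    | zero => exact fun _ v h1 h2 h3 => ⟨v, h1, h2, h3⟩
    | succ l ih =>
      exact fun hl v h1 h2 h3 => ih (by omega) _ (N.smul_mem _ h1) (Y_smul_mem M h2)
        (Y_smul_ne_zero M (by omega) hl h2 h3)
  have h1 := down l hl v v.2 hv' hv0'
  clear down hv0' hv' hv0 hv hm hl
  induction k with
  | zero => exact h1
  | succ k ih =>
    obtain ⟨v, h1, h2, h3⟩ := ih (by omega)
    exact ⟨_, N.smul_mem _ h1, X_smul_mem M h2, X_smul_ne_zero M (by omega) hk h2 h3⟩

/-- A nonzero submodule contains a nonzero vector of each weight, hence each line, hence everything.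
-/
theorem IsThin.isSimpleModule {t : M0} (M : WMod (sigma p) (orbit p) (t : ℂ[T;T⁻¹]))
    (h : IsThin ℂ[T;T⁻¹] M (orbit p)) : IsSimpleModule (GWA (sigma p) (t : ℂ[T;T⁻¹])) M := by
  obtain ⟨v, -, hv0, -⟩ := h _ (wt_mem_orbit p 0)
  have : Nontrivial M := ⟨⟨v, 0, hv0⟩⟩
  rw [isSimpleModule_iff]
  refine { eq_bot_or_eq_top := fun N => or_iff_not_imp_left.mpr fun hN => ?_ }
  have hle : ⨆ m ∈ orbit p, weightSpace ℂ[T;T⁻¹] M m ≤ N.restrictScalars ℂ[T;T⁻¹] := by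
    refine iSup₂_le fun m hm => ?_
    obtain ⟨k, hk, rfl⟩ := exists_eq_wt hm
    obtain ⟨u, huN, hu, hu0⟩ := exists_mem_weightSpace M hN hk
    refine (h.le_span hm hu hu0).trans ?_
    rw [Submodule.span_singleton_le_iff_mem]
    exact huN
  rw [M.isFinWeightOn.iSup_mem_eq_top] at hle
  rw [eq_top_iff]
  exact fun v _ => hle trivial

end module

/-! ### Structure and classification of simple weight modules -/

section simple

open LaurentPolynomial

variable {p : ℕ}

/-- Schur's lemma: central elements of `A(t)` act on simple weight modules by scalars. -/
theorem exists_smul_eq_of_central [NeZero p] {t : ℂ[T;T⁻¹]} (M : WMod (sigma p) (orbit p) t)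
    [IsSimpleModule (GWA (sigma p) t) M] {a : GWA (sigma p) t} (ha : ∀ b, Commute a b) :
    ∃ c : ℂ, ∀ v : M, a • v = c • v := by
  have : Nontrivial M := IsSimpleModule.nontrivial (GWA (sigma p) t) M
  obtain ⟨c, hc⟩ := Module.End.exists_eigenvalue (act M a)
  obtain ⟨u, hu⟩ := hc.exists_hasEigenvector
  refine ⟨c, fun v => ?_⟩
  -- The map `a - c` is `A(t)`-linear because `a` is central. It kills an eigenvector, so it is not
  -- bijective and must be zero.
  let f : M →ₗ[GWA (sigma p) t] M :=
    { toFun := fun v => a • v - c • v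
      map_add' := fun v w => by rw [smul_add, smul_add]; abel
      map_smul' := fun b v => by
        rw [← mul_smul, (ha b).eq, mul_smul, RingHom.id_apply, smul_sub, smul_comm b c] }
  have hfu : f u = 0 := sub_eq_zero.mpr hu.apply_eq_smul
  rcases LinearMap.bijective_or_eq_zero f with h | h
  · exact (hu.2 (h.1 (hfu.trans (map_zero f).symm))).elim
  · exact sub_eq_zero.mp (LinearMap.congr_fun h v)

variable {t : M0} (M : WMod (sigma p) (orbit p) (t : ℂ[T;T⁻¹]))

theorem X_pow_smul_mem {v : M} (hv : v ∈ weightSpace ℂ[T;T⁻¹] M (wt p 1)) (k : ℕ) :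
    GWA.X (sigma p) (t : ℂ[T;T⁻¹]) ^ k • v ∈ weightSpace ℂ[T;T⁻¹] M (wt p (k + 1)) := by
  induction k with
  | zero => simpa using hv
  | succ k ih => rw [pow_succ', mul_smul]; exact X_smul_mem M ih

/-- Cancelling the innermost `XY`, which acts on weight `q ^ (p - m)` by the value of `t` at `q ^ (p
- (m + 1))`, gives one factor at a time. -/
theorem X_pow_smul_Y_pow_smul {u : M} (hu : u ∈ weightSpace ℂ[T;T⁻¹] M (wt p p)) {m : ℕ}
    (hm : m < p) :
    GWA.Y (sigma p) (t : ℂ[T;T⁻¹]) ^ m • u ∈ weightSpace ℂ[T;T⁻¹] M (wt p (p - m)) ∧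
    GWA.X (sigma p) (t : ℂ[T;T⁻¹]) ^ m • GWA.Y (sigma p) (t : ℂ[T;T⁻¹]) ^ m • u =
      (∏ i ∈ Finset.range m, ev (q p ^ (p - (i + 1))) (t : ℂ[T;T⁻¹])) • u := by
  induction m with
  | zero => simpa using hu
  | succ m ih =>
    obtain ⟨h1, h2⟩ := ih (by omega)
    rw [show p - m = p - (m + 1) + 1 by omega] at h1
    rw [pow_succ' (GWA.Y _ _), mul_smul]
    refine ⟨Y_smul_mem M h1, ?_⟩
    rw [pow_succ, mul_smul, X_smul_Y_smul_of_mem M h1, smul_comm, h2, Finset.prod_range_succ,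
      mul_comm, mul_smul]

variable [NeZero p]

theorem X_pow_smul_ne_zero {v : M} (hv : v ∈ weightSpace ℂ[T;T⁻¹] M (wt p 1)) (hv0 : v ≠ 0)
    {k : ℕ} (hk : k < p) : GWA.X (sigma p) (t : ℂ[T;T⁻¹]) ^ k • v ≠ 0 := by
  induction k with
  | zero => simpa using hv0
  | succ k ih =>
    rw [pow_succ', mul_smul]
    exact X_smul_ne_zero M (by omega) hk (X_pow_smul_mem M hv k) (ih (by omega))

/-- The scalar by which `X ^ (p - 1) Y ^ (p - 1)` acts on vectors of weight `1`. -/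
def loopScalar (p : ℕ) (t : M0) : ℂ :=
  ∏ i ∈ Finset.range (p - 1), ev (q p ^ (p - (i + 1))) (t : ℂ[T;T⁻¹])

/-- The exponents of `q` occurring are `1, …, p - 1`, which avoid the zero of `t`. -/
theorem loopScalar_ne_zero (p : ℕ) [NeZero p] (t : M0) : loopScalar p t ≠ 0 := by
  refine Finset.prod_ne_zero_iff.mpr fun i hi => ?_
  have := Finset.mem_range.mp hi
  exact ev_M0_ne_zero t (by omega) (by omega)

theorem wt_self (p : ℕ) [NeZero p] : wt p p = wt p 0 :=
  MaximalSpectrum.ext (by change Ideal.span _ = Ideal.span _; rw [q_pow, pow_zero])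

/-- This determines `Y` on the one edge where `YX = t` may carry no information. As `Y v` has weight
`1 = q ^ p`, the operator `X ^ (p - 1) Y ^ (p - 1)` multiplies it by `loopScalar`, while the result
is also `X ^ (p - 1) Y ^ p v`. -/
theorem Y_smul_eq {v : M} (hv : v ∈ weightSpace ℂ[T;T⁻¹] M (wt p 1)) {c : ℂ}
    (hY : GWA.Y (sigma p) (t : ℂ[T;T⁻¹]) ^ p • v = c • v) :
    GWA.Y (sigma p) (t : ℂ[T;T⁻¹]) • v =
      ((loopScalar p t)⁻¹ * c) • GWA.X (sigma p) (t : ℂ[T;T⁻¹]) ^ (p - 1) • v := by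
  have hp : p - 1 + 1 = p := Nat.sub_add_cancel NeZero.one_le
  have h1 := Y_smul_mem M hv
  rw [← wt_self] at h1
  have h2 := (X_pow_smul_Y_pow_smul M h1 (m := p - 1) (by omega)).2
  rw [← mul_smul (GWA.Y _ _ ^ (p - 1)), ← pow_succ, hp, hY, smul_comm] at h2
  rw [mul_smul, h2]
  exact (inv_smul_smul₀ (loopScalar_ne_zero p t) _).symm

section span

variable [IsSimpleModule (GWA (sigma p) (t : ℂ[T;T⁻¹])) M]

theorem exists_smul_eq : ∃ x y : ℂ,
    (∀ v : M, GWA.X (sigma p) (t : ℂ[T;T⁻¹]) ^ p • v = x • v) ∧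
      ∀ v : M, GWA.Y (sigma p) (t : ℂ[T;T⁻¹]) ^ p • v = y • v := by
  obtain ⟨x, hx⟩ := exists_smul_eq_of_central M (GWA.commute_X_pow (sigma_pow_self p))
  obtain ⟨y, hy⟩ := exists_smul_eq_of_central M (GWA.commute_Y_pow (sigma_pow_self p))
  exact ⟨x, y, hx, hy⟩

theorem exists_mem_wt_one : ∃ v ∈ weightSpace ℂ[T;T⁻¹] M (wt p 1), v ≠ 0 := by
  have : Nontrivial M := IsSimpleModule.nontrivial (GWA (sigma p) (t : ℂ[T;T⁻¹])) M
  obtain ⟨v, -, hv, hv0⟩ := exists_mem_weightSpace M (N := ⊤) top_ne_bot (NeZero.pos p)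
  exact ⟨v, hv, hv0⟩

/-- The span is stable under both generators: at the ends of the chain, `X ^ p` being scalar closes
the cycle for `X`, and `Y_smul_eq` closes it for `Y`. -/
theorem span_X_pow_smul_eq_top {v : M} (hv : v ∈ weightSpace ℂ[T;T⁻¹] M (wt p 1)) (hv0 : v ≠ 0) :
    Submodule.span ℂ[T;T⁻¹] (Set.range fun k : Fin p =>
      GWA.X (sigma p) (t : ℂ[T;T⁻¹]) ^ (k : ℕ) • v) = ⊤ := by
  obtain ⟨x, y, hx, hy⟩ := exists_smul_eq M
  have hmem : ∀ k < p, GWA.X (sigma p) (t : ℂ[T;T⁻¹]) ^ k • v ∈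
      Submodule.span ℂ[T;T⁻¹] (Set.range fun k : Fin p =>
        GWA.X (sigma p) (t : ℂ[T;T⁻¹]) ^ (k : ℕ) • v) := fun k hk =>
    Submodule.subset_span ⟨⟨k, hk⟩, rfl⟩
  have hp := NeZero.pos p
  refine GWA.span_eq_top_of_isSimpleModule (σ := sigma p) (t := (t : ℂ[T;T⁻¹])) _ ?_ ?_
    ⟨v, ⟨⟨0, hp⟩, by simp⟩, hv0⟩
  · rintro _ ⟨⟨k, hk⟩, rfl⟩
    rw [← mul_smul, ← pow_succ']
    by_cases h : k + 1 < p
    · exact hmem _ h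
    · rw [show k + 1 = p by omega, hx, ← C_smul]
      exact Submodule.smul_mem _ _ (by simpa using hmem 0 hp)
  · rintro _ ⟨⟨k, hk⟩, rfl⟩
    obtain _ | k := k
    · dsimp only
      rw [pow_zero, one_smul, Y_smul_eq M hv (hy v), ← C_smul]
      exact Submodule.smul_mem _ _ (hmem _ (by omega))
    · dsimp only
      rw [pow_succ', mul_smul, Y_smul_X_smul_of_mem M (X_pow_smul_mem M hv k), ← C_smul]
      exact Submodule.smul_mem _ _ (hmem _ (by omega))

theorem isThin_of_isSimpleModule : IsThin ℂ[T;T⁻¹] M (orbit p) := by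
  obtain ⟨v, hv, hv0⟩ := exists_mem_wt_one M
  let w : ℕ → M := fun k => GWA.X (sigma p) (t : ℂ[T;T⁻¹]) ^ k • v
  -- The spanning vectors sorted by weight. By `weightSpace_eq` these pieces are the full weight
  -- spaces, and distinct exponents give distinct weights, so each piece over the orbit has one
  -- generator.
  let P : MaximalSpectrum ℂ[T;T⁻¹] → Submodule ℂ[T;T⁻¹] M := fun m =>
    Submodule.span ℂ[T;T⁻¹] {u | ∃ k < p, wt p (k + 1) = m ∧ u = w k}
  have hP : ∀ m, P m ≤ weightSpace ℂ[T;T⁻¹] M m := fun m => by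
    refine Submodule.span_le.mpr ?_
    rintro _ ⟨k, -, rfl, rfl⟩
    exact X_pow_smul_mem M hv k
  have hsup : ⨆ m, P m = ⊤ := by
    rw [eq_top_iff, ← span_X_pow_smul_eq_top M hv hv0, Submodule.span_le]
    rintro _ ⟨k, rfl⟩
    exact Submodule.mem_iSup_of_mem (wt p (k + 1))
      (Submodule.subset_span ⟨k, k.2, rfl, rfl⟩)
  intro m hm
  obtain ⟨k, hk, rfl⟩ := exists_eq_wt hm
  refine ⟨w k, X_pow_smul_mem M hv k, X_pow_smul_ne_zero M hv hv0 hk, ?_⟩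
  rw [weightSpace_eq P hP hsup]
  refine Submodule.span_mono ?_
  rintro _ ⟨l, hl, h, rfl⟩
  rw [wt_succ_injOn hl hk h]
  rfl

/-- The basis `v, X v, …, X ^ (p - 1) v` of a simple module, for a vector `v` of weight `q`. -/
theorem exists_basis {v : M} (hv : v ∈ weightSpace ℂ[T;T⁻¹] M (wt p 1)) (hv0 : v ≠ 0) :
    ∃ b : Module.Basis (Fin p) ℂ M,
      ∀ k, b k = GWA.X (sigma p) (t : ℂ[T;T⁻¹]) ^ (k : ℕ) • v := by
  let z : Module.End ℂ M := act M (GWA.incl _ _ (T 1))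
  have hz : ∀ u : M, z u = (T 1 : ℂ[T;T⁻¹]) • u := fun u => GWA.incl_smul _ _ _ u
  have hinj : Function.Injective fun k : Fin p => ((q p ^ ((k : ℕ) + 1) : ℂˣ) : ℂ) := by
    intro k l h
    refine Fin.ext (wt_succ_injOn k.2 l.2 (MaximalSpectrum.ext ?_))
    change Ideal.span _ = Ideal.span _
    rw [Units.ext h]
  -- The vectors are eigenvectors of `z` with the distinct eigenvalues `q ^ (k + 1)`.
  have hli := Module.End.eigenvectors_linearIndependent' z _ hinj
    (fun k : Fin p => GWA.X (sigma p) (t : ℂ[T;T⁻¹]) ^ (k : ℕ) • v) fun k => by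
      refine ⟨Module.End.mem_eigenspace_iff.mpr ?_, X_pow_smul_ne_zero M hv hv0 k.2⟩
      rw [hz, smul_of_mem M (X_pow_smul_mem M hv k), ev_T]
  refine ⟨Module.Basis.mk hli ?_, fun k => Module.Basis.mk_apply _ _ _⟩
  intro u _
  have hu : u ∈ Submodule.span ℂ[T;T⁻¹] (Set.range fun k : Fin p =>
      GWA.X (sigma p) (t : ℂ[T;T⁻¹]) ^ (k : ℕ) • v) := by
    rw [span_X_pow_smul_eq_top M hv hv0]; trivial
  obtain ⟨c, rfl⟩ := (Submodule.mem_span_range_iff_exists_fun _).mp hu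
  refine Submodule.sum_mem _ fun k _ => ?_
  rw [smul_of_mem M (X_pow_smul_mem M hv k)]
  exact Submodule.smul_mem _ _ (Submodule.subset_span ⟨k, rfl⟩)

end span

/-- Simple weight modules on which `X ^ p` and `Y ^ p` act by the same scalars are isomorphic. -/
theorem nonempty_equiv_of_isSimpleModule (N : WMod (sigma p) (orbit p) (t : ℂ[T;T⁻¹]))
    [IsSimpleModule (GWA (sigma p) (t : ℂ[T;T⁻¹])) M]
    [IsSimpleModule (GWA (sigma p) (t : ℂ[T;T⁻¹])) N] {x y : ℂ}
    (hMX : ∀ v : M, GWA.X (sigma p) (t : ℂ[T;T⁻¹]) ^ p • v = x • v)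
    (hMY : ∀ v : M, GWA.Y (sigma p) (t : ℂ[T;T⁻¹]) ^ p • v = y • v)
    (hNX : ∀ v : N, GWA.X (sigma p) (t : ℂ[T;T⁻¹]) ^ p • v = x • v)
    (hNY : ∀ v : N, GWA.Y (sigma p) (t : ℂ[T;T⁻¹]) ^ p • v = y • v) :
    Nonempty (M ≃ₗ[GWA (sigma p) (t : ℂ[T;T⁻¹])] N) := by
  obtain ⟨v, hv, hv0⟩ := exists_mem_wt_one M
  obtain ⟨v', hv', hv0'⟩ := exists_mem_wt_one N
  obtain ⟨b, hb⟩ := exists_basis M hv hv0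
  obtain ⟨b', hb'⟩ := exists_basis N hv' hv0'
  have hp := NeZero.pos p
  -- Match `X ^ k v` with `X ^ k v'`. The actions of `X`, `Y` and `R` on these bases depend only on
  -- `t`, `x` and `y`.
  let f : M ≃ₗ[ℂ] N := b.equiv b' (Equiv.refl _)
  have hf : ∀ k < p, f (GWA.X (sigma p) (t : ℂ[T;T⁻¹]) ^ k • v) =
      GWA.X (sigma p) (t : ℂ[T;T⁻¹]) ^ k • v' := fun k hk => by
    have := b.equiv_apply ⟨k, hk⟩ b' (Equiv.refl _)
    rw [hb] at this
    exact this.trans (hb' _)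
  have hcomm : ∀ a : GWA (sigma p) (t : ℂ[T;T⁻¹]),
      (∀ k < p, f (a • GWA.X (sigma p) (t : ℂ[T;T⁻¹]) ^ k • v) =
        a • GWA.X (sigma p) (t : ℂ[T;T⁻¹]) ^ k • v') → ∀ u, f (a • u) = a • f u := by
    intro a ha
    refine LinearMap.congr_fun (?_ : f.toLinearMap ∘ₗ act M a = act N a ∘ₗ f.toLinearMap)
    refine b.ext fun k => ?_
    rw [hb]
    change f (a • _) = a • f _
    rw [hf _ k.2, ha _ k.2]
  have hX := hcomm (GWA.X _ _) fun k hk => by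
    rw [← mul_smul, ← mul_smul, ← pow_succ']
    by_cases h : k + 1 < p
    · exact hf _ h
    · have h0 := hf 0 hp
      rw [pow_zero, one_smul, one_smul] at h0
      rw [show k + 1 = p by omega, hMX, hNX, map_smul, h0]
  have hY := hcomm (GWA.Y _ _) fun k hk => by
    obtain _ | k := k
    · rw [pow_zero, one_smul, one_smul, Y_smul_eq M hv (hMY v), Y_smul_eq N hv' (hNY v'),
        map_smul, hf _ (by omega)]
    · rw [pow_succ', mul_smul, mul_smul, Y_smul_X_smul_of_mem M (X_pow_smul_mem M hv k),
        Y_smul_X_smul_of_mem N (X_pow_smul_mem N hv' k), map_smul, hf _ (by omega)]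
  have hR : ∀ (r : ℂ[T;T⁻¹]) (u : M), f (r • u) = r • f u := fun r u => by
    have := hcomm (GWA.incl _ _ r) (fun k hk => by
      rw [GWA.incl_smul, GWA.incl_smul, smul_of_mem M (X_pow_smul_mem M hv k),
        smul_of_mem N (X_pow_smul_mem N hv' k), map_smul, hf k hk]) u
    rwa [GWA.incl_smul, GWA.incl_smul] at this
  exact ⟨GWA.linearEquivOf { f with map_smul' := hR } hX hY⟩

end simple

open LaurentPolynomial

/-! ### Submodules and quotients as weight modules -/

namespace WMod

variable {R : Type} [CommRing R] {σ : R ≃+* R} {ω : Set (MaximalSpectrum R)} {t : R}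

/-- A submodule of a weight module, as a weight module. -/
def ofSubmodule (M : WMod σ ω t) (N : Submodule (GWA σ t) M) : WMod σ ω t where
  carrier := N
  isFinWeightOn := M.isFinWeightOn.of_injective (GWA.restrict σ t N.subtype) N.injective_subtype

/-- The quotient of a weight module by a submodule, as a weight module. -/
def quotient (M : WMod σ ω t) (N : Submodule (GWA σ t) M) : WMod σ ω t where
  carrier := M ⧸ N
  isFinWeightOn := M.isFinWeightOn.of_surjective (GWA.restrict σ t N.mkQ) N.mkQ_surjective

theorem k0Rel_quotient (M : WMod σ ω t) (N : Submodule (GWA σ t) M) :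
    K0Rel .all (M.ofSubmodule N) M (M.quotient N) :=
  ⟨N.subtype, N.mkQ, N.injective_subtype, LinearMap.exact_subtype_mkQ N, N.mkQ_surjective⟩

end WMod

/-! ### Generators of, and functionals on, the Grothendieck rings -/

section ring

variable {R : Type} [CommRing R] {σ : R ≃+* R} {ω : Set (MaximalSpectrum R)} {S : Submonoid R}
  {k : K0Kind}

theorem GrothRing.cls_eq {t : S} {M N : WMod σ ω (t : R)} (e : M ≃ₗ[GWA σ (t : R)] N) :
    GrothRing.cls k t M = cls k t N := by
  rw [cls, cls, K0.cls_eq e]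

variable [IsFiniteOrbit σ ω]

theorem GrothRing.cls_rel {t : S} {M' M M'' : WMod σ ω (t : R)} (h : K0Rel k M' M M'') :
    GrothRing.cls k t M = cls k t M' + cls k t M'' := by
  classical
  have h1 : (1 : ℂ) ⊗ₜ[ℤ] K0.cls k M = 1 ⊗ₜ[ℤ] K0.cls k M' + 1 ⊗ₜ[ℤ] K0.cls k M'' := by
    rw [K0.cls_rel h, TensorProduct.tmul_add]
  exact (congrArg (DirectSum.of (Piece k σ ω S) (Additive.ofMul t)) h1).trans (map_add _ _ _)

open scoped Classical in
/-- The functional on the Grothendieck ring given by functionals on the homogeneous pieces. -/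
def GrothRing.lift (φ : ∀ i, Piece k σ ω S i →ₗ[ℂ] ℂ) : GrothRing k σ ω S →ₗ[ℂ] ℂ :=
  DirectSum.toModule ℂ (Additive S) ℂ φ

theorem GrothRing.lift_cls (φ : ∀ i, Piece k σ ω S i →ₗ[ℂ] ℂ) (t : S) (M : WMod σ ω (t : R)) :
    GrothRing.lift φ (cls k t M) = φ (Additive.ofMul t) ((1 : ℂ) ⊗ₜ[ℤ] K0.cls k M) := by
  classical
  exact DirectSum.toModule_lof ℂ (φ := φ) (Additive.ofMul t) _

theorem GrothRing.span_cls_eq_top : Submodule.span ℂ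
    {x : GrothRing k σ ω S | ∃ (t : S) (M : WMod σ ω (t : R)), x = cls k t M} = ⊤ := by
  classical
  rw [eq_top_iff]
  intro x _
  induction x using DirectSum.induction_on with
  | zero => exact zero_mem _
  | add x y hx hy => exact add_mem (hx trivial) (hy trivial)
  | of i x =>
    induction x using Piece.induction with
    | hadd x y hx hy => rw [map_add]; exact add_mem (hx trivial) (hy trivial)
    | h c M =>
      have h : (DirectSum.of (Piece k σ ω S) i (c ⊗ₜ[ℤ] K0.cls k M) : GrothRing k σ ω S) =
          c • cls k i.toMul M := by
        have h1 : c ⊗ₜ[ℤ] K0.cls k M = c • ((1 : ℂ) ⊗ₜ[ℤ] K0.cls k M) := by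
          rw [TensorProduct.smul_tmul', smul_eq_mul, mul_one]
        rw [h1]
        exact (DirectSum.lof ℂ (Additive S) (Piece k σ ω S) i).map_smul c _
      rw [h]
      exact Submodule.smul_mem _ _ (Submodule.subset_span ⟨_, M, rfl⟩)

end ring

/-! ### Trace functionals on the Grothendieck ring -/

section character

variable {p : ℕ} [NeZero p]

/-- The trace of the action of an element of `A(t)`, as a function on the Grothendieck group. -/
def K0.trace {t : ℂ[T;T⁻¹]} (a : GWA (sigma p) t) : K0 .all (sigma p) (orbit p) t →+ ℂ :=
  QuotientAddGroup.lift (K0Relations .all (sigma p) (orbit p) t)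
    (FreeAbelianGroup.lift fun M => LinearMap.trace ℂ M (act M a)) (by
    unfold K0Relations
    rw [AddSubgroup.closure_le]
    rintro _ ⟨M', M, M'', ⟨f, g, hf, hfg, hg⟩, rfl⟩
    have := trace_eq_add_of_exact (f := restrictC f) (g := restrictC g) hf hfg hg
      (a' := act M' a) (a := act M a) (a'' := act M'' a)
      (LinearMap.ext fun v => (map_smul f a v).symm) (LinearMap.ext fun v => map_smul g a v)
    simp [this])

theorem K0.trace_cls {t : ℂ[T;T⁻¹]} (a : GWA (sigma p) t) (M : WMod (sigma p) (orbit p) t) :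
    K0.trace a (K0.cls .all M) = LinearMap.trace ℂ M (act M a) :=
  FreeAbelianGroup.lift_apply_of _ M

/-- Evaluation at `3`, which separates the powers of `z - 1`. -/
def evThree : ℂ[T;T⁻¹] →+* ℂ := ev (Units.mk0 3 three_ne_zero)

/-- The value of `(z - 1) ^ n` at `3` is `2 ^ n`. -/
theorem evThree_injective : Function.Injective fun t : M0 => evThree t := by
  have key : ∀ n : ℕ, evThree ((T 1 - 1) ^ n) = 2 ^ n := fun n => by
    rw [map_pow, map_sub, map_one, evThree, ev_T, Units.val_mk0]
    norm_num
  rintro ⟨_, n, rfl⟩ ⟨_, m, rfl⟩ h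
  have h1 : (2 : ℂ) ^ n = 2 ^ m := (key n).symm.trans (Eq.trans h (key m))
  have h2 : (2 : ℕ) ^ n = 2 ^ m := by exact_mod_cast h1
  rw [Nat.pow_right_injective le_rfl h2]

/-- The functional `[M] ↦ t(3) ^ l tr_M(X ^ (p i) Y ^ (p j))`, for `M` in `A(t)-wmod_ω`. -/
def Piece.character (p : ℕ) [NeZero p] (l i j : ℕ) (t : Additive M0) :
    Piece .all (sigma p) (orbit p) M0 t →ₗ[ℂ] ℂ :=
  evThree (t.toMul : ℂ[T;T⁻¹]) ^ l •
    (K0.trace ((GWA.X (sigma p) (t.toMul : ℂ[T;T⁻¹]) ^ p) ^ i *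
      (GWA.Y (sigma p) (t.toMul : ℂ[T;T⁻¹]) ^ p) ^ j)).toIntLinearMap.liftBaseChange ℂ

theorem Piece.character_cls (l i j : ℕ) (t : Additive M0)
    (M : WMod (sigma p) (orbit p) (t.toMul : ℂ[T;T⁻¹])) :
    Piece.character p l i j t ((1 : ℂ) ⊗ₜ[ℤ] K0.cls .all M) =
      evThree (t.toMul : ℂ[T;T⁻¹]) ^ l *
      LinearMap.trace ℂ M (act M ((GWA.X (sigma p) (t.toMul : ℂ[T;T⁻¹]) ^ p) ^ i *
        (GWA.Y (sigma p) (t.toMul : ℂ[T;T⁻¹]) ^ p) ^ j)) := by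
  rw [Piece.character, LinearMap.smul_apply, LinearMap.liftBaseChange_tmul, one_smul, smul_eq_mul,
    AddMonoidHom.coe_toIntLinearMap, K0.trace_cls]

/-- The sum of the functionals `Piece.character p l i j t` over all `t`. -/
def character (p : ℕ) [NeZero p] (l i j : ℕ) : AGroth p →ₗ[ℂ] ℂ :=
  GrothRing.lift (Piece.character p l i j)

theorem character_cls (l i j : ℕ) (t : M0) (M : WMod (sigma p) (orbit p) (t : ℂ[T;T⁻¹])) :
    character p l i j (GrothRing.cls .all t M) = evThree (t : ℂ[T;T⁻¹]) ^ l *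
      LinearMap.trace ℂ M (act M ((GWA.X (sigma p) (t : ℂ[T;T⁻¹]) ^ p) ^ i *
        (GWA.Y (sigma p) (t : ℂ[T;T⁻¹]) ^ p) ^ j)) :=
  (GrothRing.lift_cls _ t M).trans (Piece.character_cls l i j (Additive.ofMul t) M)

/-- The monoid homomorphism `(l, i, j) ↦ a ^ l x ^ i y ^ j`. -/
def monomialHom (c : ℂ × ℂ × ℂ) : Multiplicative (ℕ × ℕ × ℕ) →* ℂ where
  toFun g := c.1 ^ g.toAdd.1 * (c.2.1 ^ g.toAdd.2.1 * c.2.2 ^ g.toAdd.2.2)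
  map_one' := by simp
  map_mul' g h := by simp only [toAdd_mul, Prod.fst_add, Prod.snd_add, pow_add]; ring

/-- The three scalars are the values at the three generators of `ℕ³`. -/
theorem monomialHom_injective : Function.Injective monomialHom := by
  intro c d h
  have key := fun g => DFunLike.congr_fun h (Multiplicative.ofAdd g)
  have h1 := key (1, 0, 0)
  have h2 := key (0, 1, 0)
  have h3 := key (0, 0, 1)
  simp only [monomialHom, MonoidHom.coe_mk, OneHom.coe_mk, toAdd_ofAdd, pow_zero, pow_one, mul_one,
    one_mul] at h1 h2 h3
  exact Prod.ext h1 (Prod.ext h2 h3)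

/-- Up to the dimension, the trace functionals on a fixed module form a multiplicative function of
the exponents, which is what Dedekind's theorem needs. -/
theorem character_cls_of_isSimpleModule (g : Multiplicative (ℕ × ℕ × ℕ)) (t : M0)
    (M : WMod (sigma p) (orbit p) (t : ℂ[T;T⁻¹])) {x y : ℂ}
    (hX : ∀ v : M, GWA.X (sigma p) (t : ℂ[T;T⁻¹]) ^ p • v = x • v)
    (hY : ∀ v : M, GWA.Y (sigma p) (t : ℂ[T;T⁻¹]) ^ p • v = y • v) :
    character p g.toAdd.1 g.toAdd.2.1 g.toAdd.2.2 (GrothRing.cls .all t M) =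
      Module.finrank ℂ M * monomialHom (evThree (t : ℂ[T;T⁻¹]), x, y) g := by
  have hX' : act M (GWA.X (sigma p) (t : ℂ[T;T⁻¹]) ^ p) = x • 1 := LinearMap.ext hX
  have hY' : act M (GWA.Y (sigma p) (t : ℂ[T;T⁻¹]) ^ p) = y • 1 := LinearMap.ext hY
  rw [character_cls, map_mul, map_pow (act M) (_ ^ p), map_pow (act M) (_ ^ p), hX', hY', smul_pow, smul_pow, one_pow, one_pow,
    smul_mul_smul_comm, one_mul, map_smul, LinearMap.trace_one, smul_eq_mul]
  simp only [monomialHom, MonoidHom.coe_mk, OneHom.coe_mk]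
  ring

end character

/-! ### Labels of simple modules -/

section label

variable {p : ℕ}

variable (p) in
/-- The scalars `(x, y)` by which `X ^ p` and `Y ^ p` act on some simple module over `A(t)`, together
with `t`. -/
def SimpleLabel : Type :=
  {c : M0 × ℂ × ℂ // ∃ M : WMod (sigma p) (orbit p) (c.1 : ℂ[T;T⁻¹]),
    IsSimpleModule (GWA (sigma p) (c.1 : ℂ[T;T⁻¹])) M ∧
      (∀ v : M, GWA.X (sigma p) (c.1 : ℂ[T;T⁻¹]) ^ p • v = c.2.1 • v) ∧
      ∀ v : M, GWA.Y (sigma p) (c.1 : ℂ[T;T⁻¹]) ^ p • v = c.2.2 • v}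

namespace SimpleLabel

/-- A simple module with the given label. -/
def toWMod (c : SimpleLabel p) : WMod (sigma p) (orbit p) (c.1.1 : ℂ[T;T⁻¹]) := c.2.choose

instance (c : SimpleLabel p) : IsSimpleModule (GWA (sigma p) (c.1.1 : ℂ[T;T⁻¹])) c.toWMod :=
  c.2.choose_spec.1

theorem X_pow_smul (c : SimpleLabel p) (v : c.toWMod) :
    GWA.X (sigma p) (c.1.1 : ℂ[T;T⁻¹]) ^ p • v = c.1.2.1 • v := c.2.choose_spec.2.1 v

theorem Y_pow_smul (c : SimpleLabel p) (v : c.toWMod) :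
    GWA.Y (sigma p) (c.1.1 : ℂ[T;T⁻¹]) ^ p • v = c.1.2.2 • v := c.2.choose_spec.2.2 v

/-- The class of the simple module with the given label. -/
def cls (c : SimpleLabel p) : ASplit p := GrothRing.cls .split c.1.1 c.toWMod

/-- The normalized character of the simple module with the given label. -/
def hom (c : SimpleLabel p) : Multiplicative (ℕ × ℕ × ℕ) →* ℂ :=
  monomialHom (evThree (c.1.1 : ℂ[T;T⁻¹]), c.1.2)

theorem hom_injective : Function.Injective (hom (p := p)) := fun c d h => by
  obtain ⟨h1, h2⟩ := Prod.mk.inj (monomialHom_injective h)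
  exact Subtype.ext (Prod.ext (evThree_injective h1) h2)

end SimpleLabel

end label

/-! ### The subalgebra of simple classes and the canonical map on it -/

section main

variable (p : ℕ) [NeZero p]

/-- The classes of the simple weight modules. -/
def simpleClasses : Set (ASplit p) :=
  {x | ∃ (t : M0) (M : WMod (sigma p) (orbit p) (t : ℂ[T;T⁻¹])),
    IsSimpleModule (GWA (sigma p) (t : ℂ[T;T⁻¹])) M ∧ x = GrothRing.cls .split t M}

variable {p}

/-- Simple and thin are equivalent, and thinness passes to tensor products. -/
theorem isSimpleModule_tensor {t t' : M0} (M : WMod (sigma p) (orbit p) (t : ℂ[T;T⁻¹]))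
    (N : WMod (sigma p) (orbit p) (t' : ℂ[T;T⁻¹]))
    (hM : IsSimpleModule (GWA (sigma p) (t : ℂ[T;T⁻¹])) M)
    (hN : IsSimpleModule (GWA (sigma p) (t' : ℂ[T;T⁻¹])) N) :
    IsSimpleModule (GWA (sigma p) ((t : ℂ[T;T⁻¹]) * (t' : ℂ[T;T⁻¹]))) (M.tensor N) :=
  IsThin.isSimpleModule (t := t * t') (M.tensor N)
    ((isThin_of_isSimpleModule M).tensor M.isFinWeightOn.isWeight N.isFinWeightOn.isWeight
      (isThin_of_isSimpleModule N))

theorem isSimpleModule_unit :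
    IsSimpleModule (GWA (sigma p) (1 : ℂ[T;T⁻¹])) (WMod.unit (sigma p) (orbit p)) :=
  IsThin.isSimpleModule (t := 1) (WMod.unit (sigma p) (orbit p))
    (IsThin.quot (isFiniteOrbit p).finite)

variable (p) in
-- The spanning sets already coincide: an indecomposable module is nonzero, so length at most one
-- forces length one.
theorem lengthSpan_one : lengthSpan p 1 = Submodule.span ℂ (simpleClasses p) := by
  refine congrArg (Submodule.span ℂ) (Set.ext fun x => ⟨?_, ?_⟩)
  · rintro ⟨t, M, hM, hl, rfl⟩
    have := hM.1
    have h1 := Module.length_pos (R := GWA (sigma p) (t : ℂ[T;T⁻¹])) (M := M)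
    exact ⟨t, M, Module.length_eq_one_iff.mp
      (le_antisymm (by exact_mod_cast hl) (Order.one_le_iff_pos.mpr h1)), rfl⟩
  · rintro ⟨t, M, hM, rfl⟩
    refine ⟨t, M, ⟨IsSimpleModule.nontrivial (GWA (sigma p) (t : ℂ[T;T⁻¹])) M, fun N P h => ?_⟩,
      (by exact_mod_cast (Module.length_eq_one_iff.mpr hM).le), rfl⟩
    rcases eq_bot_or_eq_top N with h1 | h1
    · exact Or.inl h1
    · rw [h1] at h
      exact Or.inr (eq_bot_of_top_isCompl h)

variable (p) in
/-- The subalgebra `𝒜_(1)` spanned by the classes of simple modules. -/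
def simpleSubalgebra : Subalgebra ℂ (ASplit p) :=
  (Submodule.span ℂ (simpleClasses p)).toSubalgebra
    (Submodule.subset_span ⟨1, WMod.unit _ _, isSimpleModule_unit, rfl⟩)
    (fun x y hx hy => by
      have h := Submodule.mul_mem_mul hx hy
      rw [Submodule.span_mul_span] at h
      refine Submodule.span_mono ?_ h
      rintro _ ⟨_, ⟨t, M, hM, rfl⟩, _, ⟨t', N, hN, rfl⟩, rfl⟩
      exact ⟨t * t', M.tensor N, isSimpleModule_tensor M N hM hN,
        GrothRing.cls_mul_cls .split t t' M N⟩)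

/-- Induction on the complex dimension: a proper nonzero submodule and its quotient both have
smaller dimension, and their classes add up to that of the module. -/
theorem cls_mem_map_span_simpleClasses (t : M0) (M : WMod (sigma p) (orbit p) (t : ℂ[T;T⁻¹])) :
    GrothRing.cls .all t M ∈ (Submodule.span ℂ (simpleClasses p)).map
      (GrothRing.proj (sigma p) (orbit p) M0).toLinearMap := by
  induction h : Module.finrank ℂ M using Nat.strong_induction_on generalizing M with
  | _ n ih =>
  by_cases hs : IsSimpleModule (GWA (sigma p) (t : ℂ[T;T⁻¹])) M
  · exact ⟨_, Submodule.subset_span ⟨t, M, hs, rfl⟩, GrothRing.proj_cls t M⟩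
  rcases subsingleton_or_nontrivial M with hM | hM
  -- For the zero module, `0 → M → M → M → 0` is exact, so `[M] = [M] + [M]`.
  · have hrel : K0Rel .all M M M := ⟨0, 0, Function.injective_of_subsingleton _,
      fun x => ⟨fun _ => ⟨x, Subsingleton.elim _ _⟩, fun _ => Subsingleton.elim _ _⟩,
      Function.surjective_to_subsingleton _⟩
    rw [left_eq_add.mp (GrothRing.cls_rel hrel)]
    exact zero_mem _
  obtain ⟨N, hN0, hN1⟩ : ∃ N : Submodule (GWA (sigma p) (t : ℂ[T;T⁻¹])) M, N ≠ ⊥ ∧ N ≠ ⊤ := by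
    by_contra! hN
    exact hs ((isSimpleModule_iff _ _).mpr
      { eq_bot_or_eq_top := fun N => or_iff_not_imp_left.mpr (hN N) })
  let f : M.ofSubmodule N →ₗ[ℂ] M := restrictC (M := M.ofSubmodule N) N.subtype
  let g : M →ₗ[ℂ] M.quotient N := restrictC (N := M.quotient N) N.mkQ
  have hf : Function.Injective f := N.injective_subtype
  have hg : Function.Surjective g := N.mkQ_surjective
  have hlt1 : Module.finrank ℂ (M.ofSubmodule N) < Module.finrank ℂ M := by
    refine lt_of_le_of_ne (LinearMap.finrank_le_finrank_of_injective hf) fun heq => hN1 ?_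
    have := (LinearMap.injective_iff_surjective_of_finrank_eq_finrank heq).mp hf
    exact eq_top_iff.mpr fun x _ => by obtain ⟨y, rfl⟩ := this x; exact y.2
  have hlt2 : Module.finrank ℂ (M.quotient N) < Module.finrank ℂ M := by
    refine lt_of_le_of_ne (LinearMap.finrank_le_finrank_of_surjective hg) fun heq => hN0 ?_
    have := (LinearMap.injective_iff_surjective_of_finrank_eq_finrank heq.symm).mpr hg
    exact (Submodule.eq_bot_iff _).mpr fun x hx =>
      this (((Submodule.Quotient.mk_eq_zero N).mpr hx).trans (map_zero g).symm)
  rw [GrothRing.cls_rel (M.k0Rel_quotient N)]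
  exact add_mem (ih _ (h ▸ hlt1) _ rfl) (ih _ (h ▸ hlt2) _ rfl)

variable (p) in
theorem map_span_simpleClasses_eq_top : (Submodule.span ℂ (simpleClasses p)).map
    (GrothRing.proj (sigma p) (orbit p) M0).toLinearMap = ⊤ := by
  rw [eq_top_iff, ← GrothRing.span_cls_eq_top, Submodule.span_le]
  rintro _ ⟨t, M, rfl⟩
  exact cls_mem_map_span_simpleClasses t M

namespace SimpleLabel

theorem finrank_ne_zero (c : SimpleLabel p) : (Module.finrank ℂ c.toWMod : ℂ) ≠ 0 := by
  have : Nontrivial c.toWMod :=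
    IsSimpleModule.nontrivial (GWA (sigma p) (c.1.1 : ℂ[T;T⁻¹])) c.toWMod
  exact_mod_cast Module.finrank_pos.ne'

/-- The module chosen for a label is isomorphic to any other simple module with that label. The
coordinates enter through equations so that `t` can be substituted in the type of `M`. -/
theorem cls_eq (c : SimpleLabel p) {t : M0} {x y : ℂ} (ht : t = c.1.1) (hx : x = c.1.2.1)
    (hy : y = c.1.2.2) (M : WMod (sigma p) (orbit p) (t : ℂ[T;T⁻¹]))
    (hM : IsSimpleModule (GWA (sigma p) (t : ℂ[T;T⁻¹])) M)
    (hX : ∀ v : M, GWA.X (sigma p) (t : ℂ[T;T⁻¹]) ^ p • v = x • v)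
    (hY : ∀ v : M, GWA.Y (sigma p) (t : ℂ[T;T⁻¹]) ^ p • v = y • v) :
    c.cls = GrothRing.cls .split t M := by
  subst ht hx hy
  obtain ⟨e⟩ := nonempty_equiv_of_isSimpleModule c.toWMod M c.X_pow_smul c.Y_pow_smul hX hY
  exact GrothRing.cls_eq e

theorem simpleClasses_subset_range_cls : simpleClasses p ⊆ Set.range (cls (p := p)) := by
  rintro _ ⟨t, M, hM, rfl⟩
  obtain ⟨x, y, hx, hy⟩ := exists_smul_eq M
  let c : SimpleLabel p := ⟨(t, x, y), M, hM, hx, hy⟩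
  exact ⟨c, c.cls_eq rfl rfl rfl M hM hx hy⟩

/-- Indexing by labels lists each isomorphism class once. The trace functionals send the classes to
nonzero multiples of distinct monoid homomorphisms, which are independent by Dedekind's theorem. -/
theorem linearIndependent_proj_cls : LinearIndependent ℂ
    ((GrothRing.proj (sigma p) (orbit p) M0).toLinearMap ∘ cls (p := p)) := by
  refine LinearIndependent.of_comp (LinearMap.pi fun g : Multiplicative (ℕ × ℕ × ℕ) =>
    character p g.toAdd.1 g.toAdd.2.1 g.toAdd.2.2) ?_
  -- The nonzero multiples are the dimensions; rescaling by units keeps independence.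
  have h := ((linearIndependent_monoidHom (Multiplicative (ℕ × ℕ × ℕ)) ℂ).comp _
    (hom_injective (p := p))).units_smul fun c => Units.mk0 _ c.finrank_ne_zero
  have heq : (fun c : SimpleLabel p => Units.mk0 _ c.finrank_ne_zero) •
      ((fun f : Multiplicative (ℕ × ℕ × ℕ) →* ℂ => (f : Multiplicative (ℕ × ℕ × ℕ) → ℂ)) ∘ hom) =
      (LinearMap.pi fun g : Multiplicative (ℕ × ℕ × ℕ) =>
        character p g.toAdd.1 g.toAdd.2.1 g.toAdd.2.2) ∘
        (GrothRing.proj (sigma p) (orbit p) M0).toLinearMap ∘ cls (p := p) := by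
    funext c g
    have h1 : GrothRing.proj (sigma p) (orbit p) M0 c.cls = GrothRing.cls .all c.1.1 c.toWMod :=
      GrothRing.proj_cls _ _
    rw [Function.comp_apply, LinearMap.pi_apply, Function.comp_apply, AlgHom.toLinearMap_apply, h1,
      character_cls_of_isSimpleModule g c.1.1 c.toWMod c.X_pow_smul c.Y_pow_smul]
    rfl
  rw [← heq]
  exact h

end SimpleLabel

variable (p) in
-- Vectors whose images are linearly independent have no nonzero combination in the kernel.
theorem disjoint_span_simpleClasses_ker : Disjoint (Submodule.span ℂ (simpleClasses p))
    (LinearMap.ker (GrothRing.proj (sigma p) (orbit p) M0).toLinearMap) :=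
  (Submodule.range_ker_disjoint SimpleLabel.linearIndependent_proj_cls).mono_left
    (Submodule.span_mono SimpleLabel.simpleClasses_subset_range_cls)

end main

end WeightRing

end

open WeightRing
theorem theorem5p7 (p : ℕ) [NeZero p] :
    -- the tensor product of two simple weight modules is simple
    (∀ (t t' : M0) (M : WMod (sigma p) (orbit p) (t : LaurentPolynomial ℂ))
      (N : WMod (sigma p) (orbit p) (t' : LaurentPolynomial ℂ)),
      IsSimpleModule (GWA (sigma p) (t : LaurentPolynomial ℂ)) M →
      IsSimpleModule (GWA (sigma p) (t' : LaurentPolynomial ℂ)) N →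
      IsSimpleModule (GWA (sigma p) ((t : LaurentPolynomial ℂ) * (t' : LaurentPolynomial ℂ)))
        (M.tensor N)) ∧
    -- `𝒜_(1)` is the span of the classes of simple weight modules
    lengthSpan p 1 = Submodule.span ℂ
      {x | ∃ (t : M0) (M : WMod (sigma p) (orbit p) (t : LaurentPolynomial ℂ)),
        IsSimpleModule (GWA (sigma p) (t : LaurentPolynomial ℂ)) M ∧
          x = GrothRing.cls .split t M} ∧
    -- the canonical map is surjective
    Function.Surjective (GrothRing.proj (sigma p) (orbit p) M0) ∧
    -- `𝒜_(1)` is a subalgebra, and there is an algebra section of the canonical map that gives an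
    -- isomorphism of algebras from `𝒜(ω, M₀)` to `𝒜_(1)`
    ∃ B : Subalgebra ℂ (ASplit p), Subalgebra.toSubmodule B = lengthSpan p 1 ∧
      ∃ s : AGroth p →ₐ[ℂ] ASplit p,
        (GrothRing.proj (sigma p) (orbit p) M0).comp s = AlgHom.id ℂ (AGroth p) ∧
        ∃ e : AGroth p ≃ₐ[ℂ] B, ∀ a, (e a : ASplit p) = s a := by
  have hsurj : ∀ a : AGroth p, ∃ b ∈ Submodule.span ℂ (simpleClasses p),
      GrothRing.proj (sigma p) (orbit p) M0 b = a := fun a => by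
    have : a ∈ (⊤ : Submodule ℂ (AGroth p)) := trivial
    rw [← map_span_simpleClasses_eq_top] at this
    exact this
  -- The canonical map restricted to the subalgebra is an algebra isomorphism; its inverse, followed
  -- by the inclusion, is the section.
  have hbij : Function.Bijective
      ((GrothRing.proj (sigma p) (orbit p) M0).comp (simpleSubalgebra p).val) := by
    refine ⟨(injective_iff_map_eq_zero _).mpr fun b hb => Subtype.ext ?_, fun a => ?_⟩
    · exact Submodule.disjoint_def.mp (disjoint_span_simpleClasses_ker p) b b.2 hb
    · obtain ⟨b, hb, rfl⟩ := hsurj a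
      exact ⟨⟨b, hb⟩, rfl⟩
  let e := AlgEquiv.ofBijective _ hbij
  refine ⟨fun t t' M N hM hN => isSimpleModule_tensor M N hM hN, lengthSpan_one p,
    fun a => (hsurj a).imp fun _ h => h.2, simpleSubalgebra p, (lengthSpan_one p).symm,
    (simpleSubalgebra p).val.comp e.symm, ?_, e.symm, fun _ => rfl⟩
  exact AlgHom.ext fun a => e.apply_symm_apply a
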